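/- Let $\Bbbk$ be a field and $\mathcal I$ a countable alphabet containing the natural numbers. *Wiring diagrams.* An oriented wiring diagram with inputs $(A_i^{\mathrm{out}};A_i^{\mathrm{in}})$, $1\le i\le r$, and output labels $A_0^{\mathrm{out}},A_0^{\mathrm{in}}$ (finite subsets of $\mathcal I$) is a compact oriented $1$-manifold, up to orientation-preserving homeomorphism, with its beginning points labelled bijectively by $\bigsqcup_{i\ge 0}A_i^{\mathrm{out}}$ and its ending points by $\bigsqcup_{i\ge 0}A_i^{\mathrm{in}}$; equivalently, a bijection $\bigsqcup_i A_i^{\mathrm{out}}\to\bigsqcup_i A_i^{\mathrm{in}}$ together with a number $l\ge 0$ of circles. The composite $D\circ_i D'$, defined when $A_i^{\mathrm{out}/\mathrm{in}}=B_0^{\mathrm{in}/\mathrm{out}}$, glues the output of $D'$ to the $i$-th input of $D$. An *oriented circuit algebra* is a family of $\Bbbk$-vector spaces $V[S;T]$, for finite $S,T\subseteq\mathcal I$, with linear maps $F_D:\bigotimes_{i=1}^r V[A_i^{\mathrm{out}};A_i^{\mathrm{in}}]\to V[A_0^{\mathrm{in}};A_0^{\mathrm{out}}]$ for all wiring diagrams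 $D$, compatible with compositions, identity diagrams and renumbering of inputs. Morphisms are families of linear maps commuting with all $F_D$. This is the category $\mathsf{CA}$. *Planar tangles.* An oriented planar tangle of type $(s_1,\dots,s_r;s_0)$, where the $s_i$ are finite sequences of signs $\pm1$, is a compact oriented $1$-manifold properly embedded in a disc with $r$ numbered round holes, its boundary mapped bijectively to equidistant numbered marked points on the circles, labelled by the $s_i$ ($s_0$ on the outer circle); ending points go to positive and beginning points to negative marked points. Tangles are composed by shrinking and gluing one into a hole of another, with marked points and orientations matching (so the outer sequence of the inner tangle is the negative of the sequence on the hole). An *oriented planar algebra* is a family of $\Bbbk$-vector spaces $A(s)$ indexed by sign sequences, with linear maps $A(s_1)\otimes\dots\otimes A(s_r)\to A(-s_0)$ for all planar tangles, depending only on the isotopy class of the tangle (holes may move, the outer circle is fixed) and compatible with compositions, identity tangles and renumbering of holes. Morphisms are families of linear maps commuting with all these operations. This is the category $\mathsf{PA}$. Every planar tangle $T$ has an underlying wiring diagram $\phi(T)$, obtained by forgetting the embedding, with $A_i^{\mathrm{in}}=\{j: s_{i,j}=1\}$ and $A_i^{\mathrm{out}}=\{j: s_{i,j}=-1\}$. **Proposition.**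 Composable planar tangles have a composite planar tangle. The diagram $\phi(T)$ depends only on the isotopy class of $T$, and $\phi$ is compatible with identities, with the compositions $\circ_i$ and with the symmetric group actions. Consequently every circuit algebra $V$ has an underlying planar algebra $\phi^*V$, with $(\phi^*V)(s)=V[\{j:s_j=-1\};\{j:s_j=1\}]$ and each tangle $T$ acting by $F_{\phi(T)}$; and the resulting restriction functor $\phi^*:\mathsf{CA}\to\mathsf{PA}$ has a left adjoint $\phi_!$, so that there is an adjunction $$\phi_!:\mathsf{PA}\rightleftarrows\mathsf{CA}:\phi^*.$$ -/

import Mathlib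

open CategoryTheory
open scoped unitInterval

universe w u

/-! ### Colours -/

/-- A finite sequence of signs `±1`. -/
structure SignSeq where
  len : ℕ
  sign : Fin len → ℤˣ

/-- A pair `(S^out; S^in)` of finite sets of labels from the alphabet `L`. The two sets need not be
disjoint. -/
@[ext]
structure LabelPair (L : Type) where
  out : Finset L
  inn : Finset L

/-! ### Splitting off the points along which two diagrams are glued -/

section Split

variable {C ι κ : Type} (F : C → Type) (O O' : Type) (c : ι → C) (i : ι) (c' : κ → C)

/-- `O ⊕ Σ j, F (c j)` are the boundary points (of one orientation) of a diagram with outer boundary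
points `O` and inputs `ι`, and `O' ⊕ Σ k, F (c' k)` those of a second diagram, which is to be glued
into the input `i` of the first. A boundary point of either is a boundary point of the composite,
whose inputs are `{j // j ≠ i} ⊕ κ`, or lies on the `i`-th circle of the first diagram (`F (c i)`),
or on the outer circle of the second (`O'`). -/
def splitMap :
    (O ⊕ Σ z : {j // j ≠ i} ⊕ κ, F (Sum.elim (fun j => c j.1) c' z)) ⊕ (F (c i) ⊕ O') →
      (O ⊕ Σ j, F (c j)) ⊕ (O' ⊕ Σ m, F (c' m))
  | .inl (.inl a) => .inl (.inl a)
  | .inl (.inr ⟨.inl j, a⟩) => .inl (.inr ⟨j.1, a⟩)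
  | .inl (.inr ⟨.inr m, a⟩) => .inr (.inr ⟨m, a⟩)
  | .inr (.inl a) => .inl (.inr ⟨i, a⟩)
  | .inr (.inr b) => .inr (.inl b)

theorem splitMap_bijective : Function.Bijective (splitMap F O O' c i c') := by
  constructor
  · rintro ((a | ⟨⟨j, hj⟩ | m, a⟩) | (a | b)) ((a' | ⟨⟨j', hj'⟩ | m', a'⟩) | (a' | b')) h <;>
      simp only [splitMap, Sum.inl.injEq, Sum.inr.injEq, reduceCtorEq] at h
    · rw [h]
    · obtain ⟨h1, h2⟩ := Sigma.mk.inj h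
      subst h1
      rw [eq_of_heq h2]
    · exact absurd (Sigma.mk.inj h).1 hj
    · obtain ⟨h1, h2⟩ := Sigma.mk.inj h
      subst h1
      rw [eq_of_heq h2]
    · exact absurd (Sigma.mk.inj h).1.symm hj'
    · rw [eq_of_heq (Sigma.mk.inj h).2]
    · rw [h]
  · rintro ((a | ⟨j, a⟩) | (b | ⟨m, a⟩))
    · exact ⟨.inl (.inl a), rfl⟩
    · by_cases hj : j = i
      · subst hj
        exact ⟨.inr (.inl a), rfl⟩
      · exact ⟨.inl (.inr ⟨.inl ⟨j, hj⟩, a⟩), rfl⟩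
    · exact ⟨.inr (.inr b), rfl⟩
    · exact ⟨.inl (.inr ⟨.inr m, a⟩), rfl⟩

noncomputable def splitEquiv :
    (O ⊕ Σ z : {j // j ≠ i} ⊕ κ, F (Sum.elim (fun j => c j.1) c' z)) ⊕ (F (c i) ⊕ O') ≃
      (O ⊕ Σ j, F (c j)) ⊕ (O' ⊕ Σ m, F (c' m)) :=
  Equiv.ofBijective _ (splitMap_bijective F O O' c i c')

end Split

/-! ### Gluing oriented intervals end to end

`q : X ⊕ G ≃ Y ⊕ G` describes a finite union of oriented intervals: every interval begins at an
element `z` of `X ⊕ G` and ends at `q z`. Each `g : G` is at the same time the ending point of one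
interval and the beginning point of one interval, and these are glued. What results is a union of
intervals that begin in `X` and end in `Y`, and of circles. -/

section Gluing

variable {X Y G : Type} (q : X ⊕ G ≃ Y ⊕ G)

/-- The interval that begins at `z` is followed by the interval that begins at `z'`. -/
def GlueStep (z z' : X ⊕ G) : Prop := ∃ g, q z = Sum.inr g ∧ z' = Sum.inr g

/-- The glued interval that begins at `x` ends at `y`. -/
def GlueLeads (x : X) (y : Y) : Prop :=
  ∃ z, Relation.ReflTransGen (GlueStep q) (Sum.inl x) z ∧ q z = Sum.inl y

theorem glueLeads_unique {x : X} {y y' : Y} (h : GlueLeads q x y) (h' : GlueLeads q x y') :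
    y = y' := by
  obtain ⟨z, hz, hy⟩ := h
  obtain ⟨z', hz', hy'⟩ := h'
  have hu : Relator.RightUnique (GlueStep q) := by
    rintro a b b' ⟨g, hg, rfl⟩ ⟨g', hg', rfl⟩
    rw [hg] at hg'
    exact congrArg _ (Sum.inr_injective hg')
  have key : z = z' := by
    rcases Relation.ReflTransGen.total_of_right_unique hu hz hz' with h | h
    · rcases Relation.ReflTransGen.cases_head h with h | ⟨_, ⟨g, hg, _⟩, _⟩
      · exact h
      · rw [hy] at hg; cases hg
    · rcases Relation.ReflTransGen.cases_head h with h | ⟨_, ⟨g, hg, _⟩, _⟩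
      · exact h.symm
      · rw [hy'] at hg; cases hg
  subst key
  rw [hy] at hy'
  exact Sum.inl_injective hy'

theorem glueLeads_exists [Finite G] (x : X) : ∃ y, GlueLeads q x y := by
  by_contra hno
  let R : Set (X ⊕ G) := {z | Relation.ReflTransGen (GlueStep q) (Sum.inl x) z}
  have hR : R ⊆ insert (Sum.inl x) (Set.range Sum.inr) := by
    intro z hz
    rcases Relation.ReflTransGen.cases_tail hz with h | ⟨_, _, g, _, rfl⟩
    · exact Or.inl h
    · exact Or.inr ⟨g, rfl⟩
  have hfin : Finite R := ((Set.finite_range _).insert _).subset hR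
  have hex : ∀ z : R, ∃ g : G, q z.1 = Sum.inr g := by
    rintro ⟨z, hz⟩
    rcases hq : q z with y | g
    · exact absurd ⟨y, z, hz, hq⟩ hno
    · exact ⟨g, rfl⟩
  choose f hf using hex
  let F : R → R := fun z => ⟨Sum.inr (f z), Relation.ReflTransGen.tail z.2 ⟨f z, hf z, rfl⟩⟩
  have hF : Function.Injective F := by
    intro a b hab
    have h1 : f a = f b := Sum.inr_injective (congrArg Subtype.val hab)
    apply Subtype.ext
    apply q.injective
    rw [hf a, hf b, h1]
  obtain ⟨a, ha⟩ := (Finite.injective_iff_surjective.mp hF) ⟨Sum.inl x, Relation.ReflTransGen.refl⟩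
  have := congrArg Subtype.val ha
  simp [F] at this

theorem glueLeads_symm {x : X} {y : Y} (h : GlueLeads q x y) : GlueLeads q.symm y x := by
  obtain ⟨z, hz, hy⟩ := h
  have key : ∀ z', Relation.ReflTransGen (GlueStep q) (Sum.inl x) z' →
      ∃ w, Relation.ReflTransGen (GlueStep q.symm) (q z') w ∧ q.symm w = Sum.inl x := by
    intro z' hz'
    induction hz' with
    | refl => exact ⟨_, Relation.ReflTransGen.refl, by simp⟩
    | @tail b b' hb hstep ih =>
      obtain ⟨g, hg, rfl⟩ := hstep
      obtain ⟨w, hw, hwx⟩ := ih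
      refine ⟨w, Relation.ReflTransGen.head ⟨g, by simp, hg⟩ hw, hwx⟩
  obtain ⟨w, hw, hwx⟩ := key z hz
  rw [hy] at hw
  exact ⟨w, hw, hwx⟩

/-- The perfect matching given by the intervals that result from the gluing. -/
noncomputable def glueMatching [Finite G] : X ≃ Y where
  toFun x := (glueLeads_exists q x).choose
  invFun y := (glueLeads_exists q.symm y).choose
  left_inv x := glueLeads_unique q.symm (glueLeads_exists q.symm _).choose_spec
    (glueLeads_symm q (glueLeads_exists q x).choose_spec)
  right_inv y := glueLeads_unique q (glueLeads_exists q _).choose_spec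
    (glueLeads_symm q.symm (glueLeads_exists q.symm y).choose_spec)

/-- The number of circles that result from the gluing: the number of connected components of glued
points from which no free ending point is reached. -/
noncomputable def glueCircles : ℕ :=
  Nat.card {K : Quot (fun g g' : G => q (Sum.inr g) = Sum.inr g') //
    ∀ g, Quot.mk _ g = K → ∀ y, q (Sum.inr g) ≠ Sum.inl y}

end Gluing

/-! ### Oriented wiring diagrams -/

section Wiring

variable {L ι κ : Type}

/-- The labels of the beginning points. A diagram with input label sets `A_j^out, A_j^in` (`j : ι`)
and output label sets `A_0^out, A_0^in` is given the inputs `c j = (A_j^out; A_j^in)` and the output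
`c₀ = (A_0^in; A_0^out)`, so that `c₀` is the pair which indexes the target of the associated
linear map, and so that a diagram can be glued into the input `j` when its output is `c j`. -/
abbrev BeginLabel (c : ι → LabelPair L) (c₀ : LabelPair L) : Type :=
  c₀.inn ⊕ Σ j, (c j).out

/-- The labels of the ending points. -/
abbrev EndLabel (c : ι → LabelPair L) (c₀ : LabelPair L) : Type :=
  c₀.out ⊕ Σ j, (c j).inn

/-- An oriented wiring diagram. A compact oriented `1`-manifold whose components are intervals and
circles, with its beginning and ending points labelled bijectively, is up to orientation-preserving
homeomorphism the same as a perfect matching of the labels (each interval matches its beginning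
point with its ending point) and the number of circles. -/
@[ext]
structure WiringDiagram (c : ι → LabelPair L) (c₀ : LabelPair L) where
  matching : BeginLabel c c₀ ≃ EndLabel c c₀
  circles : ℕ

namespace WiringDiagram

variable {c : ι → LabelPair L} {c₀ : LabelPair L}

/-- The identity diagram with one input. -/
def id (a : LabelPair L) : WiringDiagram (fun _ : Fin 1 => a) a where
  matching :=
    { toFun := Sum.elim (fun x => .inr ⟨0, x⟩) (fun x => .inl x.2)
      invFun := Sum.elim (fun x => .inr ⟨0, x⟩) (fun x => .inl x.2)
      left_inv := by
        rintro (x | ⟨j, x⟩)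
        · rfl
        · obtain rfl := Subsingleton.elim j 0
          rfl
      right_inv := by
        rintro (x | ⟨j, x⟩)
        · rfl
        · obtain rfl := Subsingleton.elim j 0
          rfl }
  circles := 0

/-- Renumbering the inputs. -/
def reindex (D : WiringDiagram c c₀) (e : ι ≃ κ) : WiringDiagram (fun j => c (e.symm j)) c₀ where
  matching :=
    ((Equiv.refl _).sumCongr (e.symm.sigmaCongrLeft (β := fun j => (c j).out))).trans
      (D.matching.trans
        ((Equiv.refl _).sumCongr (e.symm.sigmaCongrLeft (β := fun j => (c j).inn))).symm)
  circles := D.circles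

/-- The intervals of two diagrams `D` and `D'` as seen by the gluing of the outer circle of `D'` to
the `i`-th circle of `D`. The glued points are the elements of `A_i^out ⊔ A_i^in`. -/
noncomputable def gluingData (D : WiringDiagram c c₀) (i : ι) {c' : κ → LabelPair L}
    (D' : WiringDiagram c' (c i)) :
    BeginLabel (Sum.elim (fun j : {j // j ≠ i} => c j.1) c') c₀ ⊕ ((c i).out ⊕ (c i).inn) ≃
      EndLabel (Sum.elim (fun j : {j // j ≠ i} => c j.1) c') c₀ ⊕ ((c i).out ⊕ (c i).inn) :=
  (splitEquiv (fun a : LabelPair L => a.out) c₀.inn (c i).inn c i c').trans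
    ((D.matching.sumCongr D'.matching).trans
      ((splitEquiv (fun a : LabelPair L => a.inn) c₀.out (c i).out c i c').symm.trans
        ((Equiv.refl _).sumCongr (Equiv.sumComm _ _))))

/-- The composite `D ∘_i D'`. -/
noncomputable def comp (D : WiringDiagram c c₀) (i : ι) {c' : κ → LabelPair L}
    (D' : WiringDiagram c' (c i)) :
    WiringDiagram (Sum.elim (fun j : {j // j ≠ i} => c j.1) c') c₀ where
  matching := glueMatching (D.gluingData i D')
  circles := D.circles + D'.circles + glueCircles (D.gluingData i D')

/-- Transport along an equality of input label sets. -/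
def cast {c₁ c₂ : ι → LabelPair L} (h : c₁ = c₂) (D : WiringDiagram c₁ c₀) :
    WiringDiagram c₂ c₀ := h ▸ D

end WiringDiagram

end Wiring

/-! ### Oriented planar tangles -/

/-- The unit disc of the complex plane with numbered round holes. The `i`-th hole is the image of
the unit disc under the similarity `w ↦ center i + scale i * w`, which also fixes where the
numbering of the marked points on its boundary starts. -/
structure HoledDisc (ι : Type) where
  center : ι → ℂ
  scale : ι → ℂ
  scale_ne_zero : ∀ i, scale i ≠ 0
  hole_subset : ∀ i, Metric.closedBall (center i) ‖scale i‖ ⊆ Metric.ball 0 1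
  hole_disjoint : Pairwise fun i j =>
    Disjoint (Metric.closedBall (center i) ‖scale i‖) (Metric.closedBall (center j) ‖scale j‖)

namespace HoledDisc

variable {ι : Type} (H : HoledDisc ι)

/-- The similarity that places the unit disc into the `i`-th hole. -/
def hole (i : ι) (z : ℂ) : ℂ := H.center i + H.scale i * z

/-- The disc with holes, without its boundary circles. -/
def interior : Set ℂ := {z | ‖z‖ < 1 ∧ ∀ i, ‖H.scale i‖ < dist z (H.center i)}

end HoledDisc

/-- The `j`-th of `d` equidistant points on the unit circle. -/
noncomputable def markedPoint {d : ℕ} (j : Fin d) : ℂ :=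
  Complex.exp (2 * Real.pi * Complex.I / d) ^ (j : ℕ)

theorem markedPoint_injective {d : ℕ} : Function.Injective (markedPoint : Fin d → ℂ) := by
  intro j j' h
  have hd : d ≠ 0 := fun hd => by subst hd; exact j.elim0
  exact Fin.ext ((Complex.isPrimitiveRoot_exp d hd).pow_inj j.2 j'.2 h)

theorem norm_markedPoint {d : ℕ} (j : Fin d) : ‖markedPoint j‖ = 1 := by
  have hd : d ≠ 0 := fun hd => by subst hd; exact j.elim0
  rw [markedPoint, norm_pow, (Complex.isPrimitiveRoot_exp d hd).norm'_eq_one hd, one_pow]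

section Tangle

variable {ι κ : Type}

/-- The marked points at which a strand begins. On the inner circles these are the negative ones.
The colour `s₀` of the output is, as for wiring diagrams, the one that has to agree with the colour
of the input circle into which the tangle is glued, so that strands begin at its positive points. -/
abbrev BeginMark (s : ι → SignSeq) (s₀ : SignSeq) : Type :=
  {j : Fin s₀.len // s₀.sign j = 1} ⊕ Σ i, {j : Fin (s i).len // (s i).sign j = -1}

/-- The marked points at which a strand ends. -/
abbrev EndMark (s : ι → SignSeq) (s₀ : SignSeq) : Type :=
  {j : Fin s₀.len // s₀.sign j = -1} ⊕ Σ i, {j : Fin (s i).len // (s i).sign j = 1}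

/-- The position of a marked point at which a strand begins. -/
noncomputable def HoledDisc.beginPoint (H : HoledDisc ι) (s : ι → SignSeq) (s₀ : SignSeq) :
    BeginMark s s₀ → ℂ :=
  Sum.elim (fun j => markedPoint j.1) (fun p => H.hole p.1 (markedPoint p.2.1))

/-- The position of a marked point at which a strand ends. -/
noncomputable def HoledDisc.endPoint (H : HoledDisc ι) (s : ι → SignSeq) (s₀ : SignSeq) :
    EndMark s s₀ → ℂ :=
  Sum.elim (fun j => markedPoint j.1) (fun p => H.hole p.1 (markedPoint p.2.1))

/-- An oriented planar tangle with inputs of colours `s i` and output of colour `s₀`: an oriented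
compact `1`-manifold, namely a finite union of oriented intervals and circles, embedded in a disc
with holes so that its beginning (ending) points are mapped bijectively to the marked points
`BeginMark s s₀` (`EndMark s s₀`), and so that all its other points are mapped to the interior of
the disc with holes. The intervals are indexed by the marked points at which they begin. -/
structure PlanarTangle (s : ι → SignSeq) (s₀ : SignSeq) extends HoledDisc ι where
  matching : BeginMark s s₀ ≃ EndMark s s₀
  arc : BeginMark s s₀ → C(I, ℂ)
  circles : ℕ
  loop : Fin circles → C(UnitAddCircle, ℂ)
  arc_zero : ∀ b, arc b 0 = toHoledDisc.beginPoint s s₀ b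
  arc_one : ∀ b, arc b 1 = toHoledDisc.endPoint s s₀ (matching b)
  arc_mem : ∀ b t, t ≠ 0 → t ≠ 1 → arc b t ∈ toHoledDisc.interior
  loop_mem : ∀ l t, loop l t ∈ toHoledDisc.interior
  injective : Function.Injective
    (Sum.elim (fun p : BeginMark s s₀ × I => arc p.1 p.2)
      (fun p : Fin circles × UnitAddCircle => loop p.1 p.2))

namespace PlanarTangle

variable {s : ι → SignSeq} {s₀ : SignSeq}

/-- The image of the `1`-manifold. -/
def support (T : PlanarTangle s s₀) : Set ℂ :=
  (⋃ b, Set.range (T.arc b)) ∪ ⋃ l, Set.range (T.loop l)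

/-- `γ` runs along a strand of the tangle in the direction of its orientation. The set of these
paths is what the tangle is as an oriented submanifold, without its parametrization. -/
def IsPositivePath (T : PlanarTangle s s₀) (γ : I → ℂ) : Prop :=
  (∃ b, ∃ φ : I → I, StrictMono φ ∧ Continuous φ ∧ ∀ t, γ t = T.arc b (φ t)) ∨
    ∃ l, ∃ φ : I → ℝ, StrictMono φ ∧ Continuous φ ∧ ∀ t, γ t = T.loop l (φ t : UnitAddCircle)

/-- Isotopy of tangles: an ambient isotopy of the closed unit disc, fixed on its boundary (and
extended by the identity to the plane), that carries the holes with their marked points to the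
holes with their marked points, and strands to strands with their orientation. -/
def Isotopic (T T' : PlanarTangle s s₀) : Prop :=
  ∃ h : I → ℂ ≃ₜ ℂ, (Continuous fun p : I × ℂ => h p.1 p.2) ∧ h 0 = Homeomorph.refl ℂ ∧
    (∀ t z, 1 ≤ ‖z‖ → h t z = z) ∧
    (∀ i z, ‖z‖ ≤ 1 → h 1 (T.hole i z) = T'.hole i z) ∧
    ∀ γ : I → ℂ, T.IsPositivePath γ ↔ T'.IsPositivePath fun t => h 1 (γ t)

/-- `T''` results from shrinking `T'`, placing it into the `i`-th hole of `T`, and gluing the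
`1`-manifolds there with their orientations. -/
def IsComp (T : PlanarTangle s s₀) (i : ι) {s' : κ → SignSeq} (T' : PlanarTangle s' (s i))
    (T'' : PlanarTangle (Sum.elim (fun j : {j // j ≠ i} => s j.1) s') s₀) : Prop :=
  (∀ j : {j // j ≠ i}, ∀ z, T''.hole (.inl j) z = T.hole j.1 z) ∧
    (∀ m, ∀ z, T''.hole (.inr m) z = T.hole i (T'.hole m z)) ∧
    T''.support = T.support ∪ T.hole i '' T'.support ∧
    (∀ γ, T.IsPositivePath γ → T''.IsPositivePath γ) ∧
    ∀ γ, T'.IsPositivePath γ → T''.IsPositivePath fun t => T.hole i (γ t)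

/-- Renumbering the holes. -/
def reindex (T : PlanarTangle s s₀) (e : ι ≃ κ) : PlanarTangle (fun j => s (e.symm j)) s₀ where
  center j := T.center (e.symm j)
  scale j := T.scale (e.symm j)
  scale_ne_zero j := T.scale_ne_zero _
  hole_subset j := T.hole_subset _
  hole_disjoint _ _ h := T.hole_disjoint (fun h' => h (e.symm.injective h'))
  matching :=
    ((Equiv.refl _).sumCongr
      (e.symm.sigmaCongrLeft (β := fun i => {j : Fin (s i).len // (s i).sign j = -1}))).trans
      (T.matching.trans
        ((Equiv.refl _).sumCongr
          (e.symm.sigmaCongrLeft (β := fun i => {j : Fin (s i).len // (s i).sign j = 1}))).symm)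
  arc b := T.arc ((Equiv.refl _).sumCongr
      (e.symm.sigmaCongrLeft (β := fun i => {j : Fin (s i).len // (s i).sign j = -1})) b)
  circles := T.circles
  loop := T.loop
  arc_zero b := by
    rw [T.arc_zero]
    rcases b with b | ⟨i, b⟩ <;> rfl
  arc_one b := by
    rw [T.arc_one]
    set E := (Equiv.refl {j : Fin s₀.len // s₀.sign j = -1}).sumCongr
      (e.symm.sigmaCongrLeft (β := fun i => {j : Fin (s i).len // (s i).sign j = 1})) with hE
    have key : ∀ y, T.endPoint s s₀ (E y) = Sum.elim (fun j => markedPoint j.1)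
        (fun p : Σ i, {j : Fin (s (e.symm i)).len // (s (e.symm i)).sign j = 1} =>
          T.hole (e.symm p.1) (markedPoint p.2.1)) y := by
      rintro (y | ⟨i, y⟩) <;> rfl
    have := key (E.symm (T.matching ((Equiv.refl _).sumCongr
      (e.symm.sigmaCongrLeft (β := fun i => {j : Fin (s i).len // (s i).sign j = -1})) b)))
    rw [Equiv.apply_symm_apply] at this
    exact this
  arc_mem b t h0 h1 := by
    have := T.arc_mem ((Equiv.refl _).sumCongr
      (e.symm.sigmaCongrLeft (β := fun i => {j : Fin (s i).len // (s i).sign j = -1})) b) t h0 h1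
    exact ⟨this.1, fun i => this.2 _⟩
  loop_mem l t := by
    have := T.loop_mem l t
    exact ⟨this.1, fun i => this.2 _⟩
  injective := by
    have h := T.injective.comp ((Equiv.prodCongr ((Equiv.refl _).sumCongr
      (e.symm.sigmaCongrLeft (β := fun i => {j : Fin (s i).len // (s i).sign j = -1})))
      (Equiv.refl I)).sumCongr (Equiv.refl (Fin T.circles × UnitAddCircle))).injective
    convert h using 1
    funext x
    rcases x with ⟨b, t⟩ | ⟨l, t⟩ <;> rfl

/-- The radial strands of the identity tangle, parametrized from the inside to the outside. -/
noncomputable def radial (z : ℂ) (t : ℝ) : ℂ := ((1 + t) / 2 : ℝ) * z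

theorem radial_inj {z z' : ℂ} (hz : ‖z‖ = 1) (hz' : ‖z'‖ = 1) {t t' : ℝ} (ht : 0 ≤ t) (ht' : 0 ≤ t')
    (h : radial z t = radial z' t') : z = z' ∧ t = t' := by
  have hn := congrArg norm h
  simp only [radial, norm_mul, Complex.norm_real, hz, hz', mul_one, Real.norm_eq_abs] at hn
  rw [abs_of_nonneg (by linarith), abs_of_nonneg (by linarith)] at hn
  have htt : t = t' := by linarith
  subst htt
  refine ⟨mul_left_cancel₀ ?_ h, rfl⟩
  exact Complex.ofReal_ne_zero.mpr (by linarith)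

/-- The identity tangle: the hole is the concentric disc of radius `1/2`, and the strands are radial
segments. -/
noncomputable def id (a : SignSeq) : PlanarTangle (fun _ : Fin 1 => a) a where
  center _ := 0
  scale _ := 1 / 2
  scale_ne_zero _ := by norm_num
  hole_subset _ := Metric.closedBall_subset_ball (by norm_num)
  hole_disjoint i j h := absurd (Subsingleton.elim i j) h
  matching :=
    { toFun := Sum.elim (fun x => .inr ⟨0, x⟩) (fun x => .inl x.2)
      invFun := Sum.elim (fun x => .inr ⟨0, x⟩) (fun x => .inl x.2)
      left_inv := by
        rintro (x | ⟨j, x⟩)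
        · rfl
        · obtain rfl := Subsingleton.elim j 0
          rfl
      right_inv := by
        rintro (x | ⟨j, x⟩)
        · rfl
        · obtain rfl := Subsingleton.elim j 0
          rfl }
  arc := Sum.elim
    (fun j => ⟨fun t => radial (markedPoint j.1) (1 - (t : ℝ)), by unfold radial; fun_prop⟩)
    (fun p => ⟨fun t => radial (markedPoint p.2.1) (t : ℝ), by unfold radial; fun_prop⟩)
  circles := 0
  loop l := l.elim0
  arc_zero := by
    rintro (j | ⟨i, j⟩)
    · simp [radial, HoledDisc.beginPoint]
    · simp [radial, HoledDisc.beginPoint, HoledDisc.hole]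
  arc_one := by
    rintro (j | ⟨i, j⟩)
    · simp [radial, HoledDisc.endPoint, HoledDisc.hole]
    · simp [radial, HoledDisc.endPoint]
  arc_mem := by
    have key : ∀ z : ℂ, ‖z‖ = 1 → ∀ t : ℝ, 0 < t → t < 1 →
        ‖radial z t‖ < 1 ∧ ∀ _ : Fin 1, ‖(1 / 2 : ℂ)‖ < dist (radial z t) 0 := by
      intro z hz t h0 h1
      have : ‖radial z t‖ = (1 + t) / 2 := by
        rw [radial, norm_mul, hz, mul_one, Complex.norm_real, Real.norm_eq_abs,
          abs_of_nonneg (by linarith)]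
      rw [dist_zero_right, this]
      refine ⟨by linarith, fun _ => ?_⟩
      norm_num
      linarith
    rintro (j | ⟨i, j⟩) t h0 h1
    · have h0' := unitInterval.pos_iff_ne_zero.mpr h0
      have h1' := unitInterval.lt_one_iff_ne_one.mpr h1
      exact key _ (norm_markedPoint _) (1 - (t : ℝ)) (sub_pos.mpr h1') (sub_lt_self _ h0')
    · have h0' := unitInterval.pos_iff_ne_zero.mpr h0
      have h1' := unitInterval.lt_one_iff_ne_one.mpr h1
      exact key _ (norm_markedPoint _) t h0' h1'
  loop_mem l := l.elim0
  injective := by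
    rintro (⟨j | ⟨i, j⟩, t⟩ | ⟨l, _⟩) (⟨j' | ⟨i', j'⟩, t'⟩ | ⟨l', _⟩) h
    rotate_left 2
    · exact l'.elim0
    rotate_left 2
    · exact l'.elim0
    · exact l.elim0
    · exact l.elim0
    · exact l.elim0
    · obtain ⟨h1, h2⟩ := radial_inj (norm_markedPoint _) (norm_markedPoint _)
        (sub_nonneg.mpr t.2.2) (sub_nonneg.mpr t'.2.2) h
      obtain rfl : j = j' := Subtype.ext (markedPoint_injective h1)
      obtain rfl : t = t' := Subtype.ext (sub_right_injective h2)
      rfl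
    · obtain ⟨h1, h2⟩ := radial_inj (norm_markedPoint _) (norm_markedPoint _)
        (sub_nonneg.mpr t.2.2) t'.2.1 h
      have h3 : j.1 = j'.1 := markedPoint_injective h1
      have h4 := j.2
      rw [h3, j'.2] at h4
      exact absurd h4 (by decide)
    · obtain ⟨h1, h2⟩ := radial_inj (norm_markedPoint _) (norm_markedPoint _)
        t.2.1 (sub_nonneg.mpr t'.2.2) h
      have h3 : j.1 = j'.1 := markedPoint_injective h1
      have h4 := j.2
      rw [h3, j'.2] at h4
      exact absurd h4 (by decide)
    · obtain ⟨h1, h2⟩ := radial_inj (norm_markedPoint _) (norm_markedPoint _) t.2.1 t'.2.1 h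
      obtain rfl : j = j' := Subtype.ext (markedPoint_injective h1)
      obtain rfl : t = t' := Subtype.ext h2
      obtain rfl := Subsingleton.elim i i'
      rfl

end PlanarTangle

/-! ### The wiring diagram of a planar tangle -/

variable {L : Type}

/-- The labels of those positions in `1, …, d` (numbered here by `Fin d`) that satisfy `P`; the
natural number `n` is the label `ν n`. -/
def labelsOf (ν : ℕ ↪ L) {d : ℕ} (P : Fin d → Prop) [DecidablePred P] : Finset L :=
  (Finset.univ.filter P).map ⟨fun j : Fin d => ν (j + 1), fun j j' h => by
    have := ν.injective h
    exact Fin.ext (by simpa using this)⟩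

noncomputable def labelsOfEquiv (ν : ℕ ↪ L) {d : ℕ} (P : Fin d → Prop) [DecidablePred P] :
    {j // P j} ≃ labelsOf ν P :=
  Equiv.ofBijective
    (fun j => ⟨ν (j.1 + 1), Finset.mem_map.mpr ⟨j.1, by simp [j.2], rfl⟩⟩) <| by
      constructor
      · intro j j' h
        have := ν.injective (congrArg Subtype.val h)
        exact Subtype.ext (Fin.ext (by simpa using this))
      · rintro ⟨x, hx⟩
        obtain ⟨j, hj, rfl⟩ := Finset.mem_map.mp hx
        exact ⟨⟨j, by simpa using hj⟩, rfl⟩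

/-- The pair of label sets `({j : s_j = -1}; {j : s_j = 1})` of a sign sequence `s`. -/
def SignSeq.labels (ν : ℕ ↪ L) (s : SignSeq) : LabelPair L where
  out := labelsOf ν fun j => s.sign j = -1
  inn := labelsOf ν fun j => s.sign j = 1

theorem labels_comp_elim (ν : ℕ ↪ L) (s : ι → SignSeq) (i : ι) (s' : κ → SignSeq) :
    (fun z => (Sum.elim (fun j : {j // j ≠ i} => s j.1) s' z).labels ν) =
      Sum.elim (fun j : {j // j ≠ i} => (s j.1).labels ν) (fun m => (s' m).labels ν) := by
  funext z
  rcases z with z | z <;> rfl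

/-- The label of a marked point at which a strand begins. -/
noncomputable def beginLabelEquiv (ν : ℕ ↪ L) (s : ι → SignSeq) (s₀ : SignSeq) :
    BeginMark s s₀ ≃ BeginLabel (fun i => (s i).labels ν) (s₀.labels ν) :=
  (labelsOfEquiv ν fun j => s₀.sign j = 1).sumCongr
    (Equiv.sigmaCongrRight fun i => labelsOfEquiv ν fun j => (s i).sign j = -1)

/-- The label of a marked point at which a strand ends. -/
noncomputable def endLabelEquiv (ν : ℕ ↪ L) (s : ι → SignSeq) (s₀ : SignSeq) :
    EndMark s s₀ ≃ EndLabel (fun i => (s i).labels ν) (s₀.labels ν) :=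
  (labelsOfEquiv ν fun j => s₀.sign j = -1).sumCongr
    (Equiv.sigmaCongrRight fun i => labelsOfEquiv ν fun j => (s i).sign j = 1)

/-- The wiring diagram of a planar tangle: forget how the `1`-manifold is embedded, and remember
only the labels of its boundary points. -/
noncomputable def PlanarTangle.forget {s : ι → SignSeq} {s₀ : SignSeq} (ν : ℕ ↪ L)
    (T : PlanarTangle s s₀) : WiringDiagram (fun i => (s i).labels ν) (s₀.labels ν) where
  matching := (beginLabelEquiv ν s s₀).symm.trans (T.matching.trans (endLabelEquiv ν s s₀))
  circles := T.circles

end Tangle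

/-! ### Families of vector spaces with operations -/

/-- A family of `k`-vector spaces indexed by a set `C` of colours, with a linear map
`V (c 1) ⊗ ⋯ ⊗ V (c r) → V c₀` for every element of `P c c₀`. -/
structure OperadAction (k : Type u) [Field k] {C : Type}
    (P : ∀ ⦃r : ℕ⦄, (Fin r → C) → C → Type) where
  V : C → ModuleCat.{w} k
  act : ∀ ⦃r : ℕ⦄ ⦃c : Fin r → C⦄ ⦃c₀ : C⦄, P c c₀ →
    MultilinearMap k (fun j => V (c j)) (V c₀)

namespace OperadAction

variable {k : Type u} [Field k] {C : Type} {P : ∀ ⦃r : ℕ⦄, (Fin r → C) → C → Type}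

/-- A family of linear maps that commutes with the operations. -/
@[ext]
structure Hom (A B : OperadAction.{w} k P) where
  app : ∀ c, A.V c →ₗ[k] B.V c
  comm : ∀ ⦃r : ℕ⦄ ⦃c : Fin r → C⦄ ⦃c₀ : C⦄ (D : P c c₀) (x : ∀ j, A.V (c j)),
    app c₀ (A.act D x) = B.act D fun j => app (c j) (x j)

instance : Category (OperadAction.{w} k P) where
  Hom := Hom
  id A := ⟨fun _ => LinearMap.id, fun _ _ _ _ _ => rfl⟩
  comp f g := ⟨fun c => (g.app c).comp (f.app c), fun _ _ _ D x => by
    simp only [LinearMap.comp_apply, f.comm, g.comm]⟩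

end OperadAction

/-- The element `v` at the place `i` and the elements `x j` at the other places. -/
def plug {ι : Type} [DecidableEq ι] {X : ι → Type w} (i : ι) (x : ∀ j : {j // j ≠ i}, X j.1)
    (v : X i) (j : ι) : X j :=
  if h : j = i then h.symm ▸ v else x ⟨j, h⟩

section Algebras

variable (k : Type u) [Field k] (L : Type)

abbrev CircuitAction := OperadAction.{w} k fun _ c c₀ => WiringDiagram (L := L) c c₀

abbrev PlanarAction := OperadAction.{w} k fun _ s s₀ => PlanarTangle s s₀

variable {k L}

/-- The axioms of an oriented circuit algebra. -/
structure IsCircuitAlgebra (A : CircuitAction.{w} k L) : Prop where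
  /-- Identity diagrams act as identities. -/
  unit : ∀ (a : LabelPair L) (x : Fin 1 → A.V a), A.act (WiringDiagram.id a) x = x 0
  /-- `D ∘_i D'`, with its inputs numbered in any way `e`, acts as the composite of the actions. -/
  comp : ∀ {r r' t : ℕ} {c : Fin r → LabelPair L} {c₀ : LabelPair L} (D : WiringDiagram c c₀)
    (i : Fin r) {c' : Fin r' → LabelPair L} (D' : WiringDiagram c' (c i))
    (e : {j // j ≠ i} ⊕ Fin r' ≃ Fin t)
    (x : ∀ z, A.V (Sum.elim (fun j : {j // j ≠ i} => c j.1) c' z)),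
    A.act ((D.comp i D').reindex e) (fun j => x (e.symm j)) =
      A.act D (plug (X := fun j => A.V (c j)) i (fun j => x (.inl j))
        (A.act D' fun m => x (.inr m)))
  /-- Equivariance under renumbering the inputs. -/
  perm : ∀ {r : ℕ} {c : Fin r → LabelPair L} {c₀ : LabelPair L} (D : WiringDiagram c c₀)
    (e : Equiv.Perm (Fin r)) (x : ∀ j, A.V (c j)),
    A.act (D.reindex e) (fun j => x (e.symm j)) = A.act D x

/-- The axioms of an oriented planar algebra. -/
structure IsPlanarAlgebra (A : PlanarAction.{w} k) : Prop where
  /-- The action depends only on the isotopy class of the tangle. -/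
  isotopy : ∀ {r : ℕ} {s : Fin r → SignSeq} {s₀ : SignSeq} (T T' : PlanarTangle s s₀),
    T.Isotopic T' → A.act T = A.act T'
  /-- Identity tangles act as identities. -/
  unit : ∀ (a : SignSeq) (x : Fin 1 → A.V a), A.act (PlanarTangle.id a) x = x 0
  /-- The composite of `T` and `T'`, with its inputs numbered in any way `e`, acts as the composite
  of the actions. -/
  comp : ∀ {r r' t : ℕ} {s : Fin r → SignSeq} {s₀ : SignSeq} (T : PlanarTangle s s₀)
    (i : Fin r) {s' : Fin r' → SignSeq} (T' : PlanarTangle s' (s i))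
    (T'' : PlanarTangle (Sum.elim (fun j : {j // j ≠ i} => s j.1) s') s₀)
    (e : {j // j ≠ i} ⊕ Fin r' ≃ Fin t)
    (x : ∀ z, A.V (Sum.elim (fun j : {j // j ≠ i} => s j.1) s' z)), T.IsComp i T' T'' →
    A.act (T''.reindex e) (fun j => x (e.symm j)) =
      A.act T (plug (X := fun j => A.V (s j)) i (fun j => x (.inl j))
        (A.act T' fun m => x (.inr m)))
  /-- Equivariance under renumbering the inputs. -/
  perm : ∀ {r : ℕ} {s : Fin r → SignSeq} {s₀ : SignSeq} (T : PlanarTangle s s₀)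
    (e : Equiv.Perm (Fin r)) (x : ∀ j, A.V (s j)),
    A.act (T.reindex e) (fun j => x (e.symm j)) = A.act T x

variable (k L)

/-- The category of oriented circuit algebras. -/
abbrev CircuitAlgebra :=
  ObjectProperty.FullSubcategory (IsCircuitAlgebra : CircuitAction.{w} k L → Prop)

/-- The category of oriented planar algebras. -/
abbrev PlanarAlgebra :=
  ObjectProperty.FullSubcategory (IsPlanarAlgebra : PlanarAction.{w} k → Prop)

variable {k L}

/-- Restriction along `forget`: a planar tangle acts through its wiring diagram. -/
noncomputable def restrictAction (ν : ℕ ↪ L) : CircuitAction.{w} k L ⥤ PlanarAction.{w} k where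
  obj A := { V := fun s => A.V (s.labels ν), act := fun _ _ _ T => A.act (T.forget ν) }
  map f := ⟨fun s => f.app (s.labels ν), fun _ _ _ T x => f.comm (T.forget ν) x⟩

/-- The functor `φ^*` from circuit algebras to planar algebras, given that restriction along
`forget` turns circuit algebras into planar algebras. -/
noncomputable def restriction (ν : ℕ ↪ L)
    (h : ∀ A : CircuitAction.{w} k L, IsCircuitAlgebra A →
      IsPlanarAlgebra ((restrictAction ν).obj A)) :
    CircuitAlgebra.{w} k L ⥤ PlanarAlgebra.{w} k :=
  ObjectProperty.lift _ (ObjectProperty.ι _ ⋙ restrictAction ν) fun A => h A.obj A.property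

end Algebras

/-! Composites exist by cutting and pasting. The strands of `T`, together with those of `T'` moved
into the hole by a similarity, are embedded and disjoint except that the end of one interval may be
the beginning of an interval (`pieces_weaklyEmbedded`). Such junctions are removed one at a time: an
interval is closed to a circle or two intervals are concatenated. This changes neither the support,
nor the set of beginnings that are not ends, nor the set of ends that are not beginnings, and
positive paths stay positive (`GluesTo`). When no junction is left (`exists_embedded`), the
remaining beginnings and ends are exactly the marked points of the composite.

`IsComp` fixes a composite only through its holes, its support and its positive paths, so the wiring
diagram has to be recovered from these. Each piece lies on a single strand of the composite, and
consecutive pieces share a point; so a chain of pieces lies on one strand, and this gives the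
matching (`IsComp.matching_eq`). For the circles, the support is a finite disjoint union of closed
sets in two ways: by classes of glued pieces and by strands of the composite. Connectedness makes
the two decompositions agree (`exists_glued_equiv`). Orientation tells which classes are circles:
along an interval a positive path strictly advances, so neither a loop nor a finite class without
free end fits into one (`card_loops_of_glued`). Isotopy invariance is the same argument with nothing
to glue, applied to the image of the tangle under the final homeomorphism.

The left adjoint is built from generators: formal expressions in elements of `A`, linear operations
and wiring diagrams, identified when they agree under every morphism from `A` to a circuit algebra.
All axioms hold in the quotient because they hold after each evaluation. Evaluation extends a
morphism from `A`, and induction on expressions (`eval_of_hom`) makes the extension unique.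
Expressions involve scalars, hence the universe `max u w`; the quotient then lies in the same
universe as the algebras used to define it. -/

/-! ### Reparametrizing intervals -/

/-- The increasing map of the unit interval onto its first half. -/
noncomputable def firstHalf (t : I) : I := ⟨t / 2, by constructor <;> linarith [t.2.1, t.2.2]⟩

/-- The increasing map of the unit interval onto its second half. -/
noncomputable def secondHalf (t : I) : I := ⟨(t + 1) / 2, by constructor <;> linarith [t.2.1, t.2.2]⟩

theorem firstHalf_strictMono : StrictMono firstHalf := fun t t' h => by
  have : (t : ℝ) < t' := h
  exact Subtype.mk_lt_mk.mpr (by linarith)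

theorem secondHalf_strictMono : StrictMono secondHalf := fun t t' h => by
  have : (t : ℝ) < t' := h
  exact Subtype.mk_lt_mk.mpr (by linarith)

theorem continuous_firstHalf : Continuous firstHalf := by
  unfold firstHalf; fun_prop

theorem continuous_secondHalf : Continuous secondHalf := by
  unfold secondHalf; fun_prop

theorem firstHalf_zero : firstHalf 0 = 0 := Subtype.ext (by simp [firstHalf])

theorem secondHalf_one : secondHalf 1 = 1 := Subtype.ext (by norm_num [secondHalf])

theorem firstHalf_one : firstHalf 1 = secondHalf 0 := Subtype.ext (by norm_num [firstHalf, secondHalf])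

theorem eq_firstHalf_or_secondHalf (t : I) : (∃ u, t = firstHalf u) ∨ ∃ u, t = secondHalf u := by
  rcases le_total (t : ℝ) (1 / 2) with h | h
  · exact .inl ⟨⟨2 * t, by constructor <;> linarith [t.2.1]⟩, Subtype.ext (by simp [firstHalf])⟩
  · exact .inr ⟨⟨2 * t - 1, by constructor <;> linarith [t.2.2]⟩,
      Subtype.ext (by simp [secondHalf])⟩

/-- Pasting along the midpoint, where `h` makes the two formulas agree; `Set.projIcc` only serves to
make each formula defined on both halves. -/
theorem exists_concat (c c' : C(I, ℂ)) (h : c 1 = c' 0) :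
    ∃ d : C(I, ℂ), (∀ t, d (firstHalf t) = c t) ∧ ∀ t, d (secondHalf t) = c' t := by
  let f : I → ℂ := fun t => if (t : ℝ) ≤ 1 / 2 then c (Set.projIcc 0 1 zero_le_one (2 * (t : ℝ)))
    else c' (Set.projIcc 0 1 zero_le_one (2 * (t : ℝ) - 1))
  have hf : Continuous f := by
    refine Continuous.if_le ?_ ?_ (by fun_prop) (by fun_prop) ?_
    · exact c.continuous.comp (continuous_projIcc.comp (by fun_prop))
    · exact c'.continuous.comp (continuous_projIcc.comp (by fun_prop))
    · intro t ht
      rw [ht, Set.projIcc_of_right_le _ (by norm_num), Set.projIcc_of_le_left _ (by norm_num)]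
      exact h
  have h1 : ∀ t, f (firstHalf t) = c t := by
    intro t
    have ht : ((firstHalf t : I) : ℝ) = t / 2 := rfl
    have : (t : ℝ) / 2 ≤ 1 / 2 := by linarith [t.2.2]
    simp only [f, ht, if_pos this]
    rw [mul_div_cancel₀ _ two_ne_zero, Set.projIcc_val]
  refine ⟨⟨f, hf⟩, h1, fun t => ?_⟩
  -- The midpoint belongs to the first branch of the `if`, so the value there is obtained from
  -- `firstHalf 1`.
  rcases eq_or_ne t 0 with rfl | h0
  · rw [← firstHalf_one, ← h]
    exact h1 1
  · have ht : ((secondHalf t : I) : ℝ) = (t + 1) / 2 := rfl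
    have h0' : (0 : ℝ) < t := unitInterval.pos_iff_ne_zero.mpr h0
    have : ¬ ((t : ℝ) + 1) / 2 ≤ 1 / 2 := by linarith
    simp only [ContinuousMap.coe_mk, f, ht, if_neg this]
    rw [mul_div_cancel₀ _ two_ne_zero, add_sub_cancel_right, Set.projIcc_val]

/-- The representative is the fractional part. Excluding `1` rules out the coincidence of the two
ends when an interval is closed up, which is what the injectivity of the resulting circle needs. -/
theorem exists_unitInterval_coe (x : UnitAddCircle) :
    ∃ t : I, t ≠ 1 ∧ ((t : ℝ) : UnitAddCircle) = x := by
  obtain ⟨y, rfl⟩ := QuotientAddGroup.mk_surjective x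
  refine ⟨⟨Int.fract y, Int.fract_nonneg y, (Int.fract_lt_one y).le⟩, ?_, ?_⟩
  · intro h
    exact (Int.fract_lt_one y).ne (congrArg Subtype.val h)
  · refine QuotientAddGroup.eq.mpr (AddSubgroup.mem_zmultiples_iff.mpr ⟨⌊y⌋, ?_⟩)
    simp only [Int.fract, zsmul_eq_mul, mul_one]
    ring

theorem unitAddCircle_coe_one : ((1 : ℝ) : UnitAddCircle) = 0 := AddCircle.coe_period 1

theorem exists_closed_loop (c : C(I, ℂ)) (h : c 0 = c 1) :
    ∃ l : C(UnitAddCircle, ℂ), ∀ t : I, l ((t : ℝ) : UnitAddCircle) = c t := by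
  let f : ℝ → ℂ := fun t => c (Set.projIcc 0 1 zero_le_one t)
  have h0 : f 0 = c 0 := by simp only [f]; rw [Set.projIcc_left]; rfl
  have h1 : f 1 = c 1 := by simp only [f]; rw [Set.projIcc_right]; rfl
  refine ⟨⟨AddCircle.liftIco 1 0 f, AddCircle.liftIco_zero_continuous (by rw [h0, h1, h])
    (c.continuous.comp continuous_projIcc).continuousOn⟩, fun t => ?_⟩
  rcases eq_or_ne t 1 with rfl | ht
  · have := AddCircle.liftIco_zero_coe_apply (p := (1 : ℝ)) (f := f) (x := 0) (by simp)
    simp only [ContinuousMap.coe_mk, Set.Icc.coe_one, unitAddCircle_coe_one]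
    rw [← h, ← h0, ← this]
    rfl
  · have := AddCircle.liftIco_zero_coe_apply (p := (1 : ℝ)) (f := f) (x := t)
      ⟨t.2.1, unitInterval.lt_one_iff_ne_one.mpr ht⟩
    simp only [ContinuousMap.coe_mk, this, f]
    rw [Set.projIcc_val]

/-! ### Families of strands in the plane -/

/-- A family of oriented intervals and circles mapped to the plane. -/
structure Strands (A Λ : Type) where
  arc : A → C(I, ℂ)
  loop : Λ → C(UnitAddCircle, ℂ)

namespace Strands

variable {A Λ A' Λ' : Type} (S : Strands A Λ)

/-- The union of the strands. -/
def support : Set ℂ := (⋃ b, Set.range (S.arc b)) ∪ ⋃ l, Set.range (S.loop l)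

/-- `γ` runs along a strand in the direction of its orientation. -/
def IsPositivePath (γ : I → ℂ) : Prop :=
  (∃ b, ∃ φ : I → I, StrictMono φ ∧ Continuous φ ∧ ∀ t, γ t = S.arc b (φ t)) ∨
    ∃ l, ∃ φ : I → ℝ, StrictMono φ ∧ Continuous φ ∧ ∀ t, γ t = S.loop l (φ t : UnitAddCircle)

theorem isPositivePath_arc (a : A) : S.IsPositivePath (S.arc a) :=
  .inl ⟨a, _root_.id, strictMono_id, continuous_id, fun _ => rfl⟩

theorem isPositivePath_loop (l : Λ) :
    S.IsPositivePath fun t : I => S.loop l ((t : ℝ) : UnitAddCircle) :=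
  .inr ⟨l, Subtype.val, fun _ _ h => h, continuous_subtype_val, fun _ => rfl⟩

/-- The strands are embedded and disjoint. -/
structure Embedded : Prop where
  arc_eq : ∀ {a t a' t'}, S.arc a t = S.arc a' t' → a = a' ∧ t = t'
  arc_ne_loop : ∀ a t l u, S.arc a t ≠ S.loop l u
  loop_eq : ∀ {l u l' u'}, S.loop l u = S.loop l' u' → l = l' ∧ u = u'

/-- The strands are embedded and disjoint, except that the ending point of an interval may be the
beginning point of an interval. -/
structure WeaklyEmbedded : Prop where
  arc_eq : ∀ {a t a' t'}, S.arc a t = S.arc a' t' →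
    (a = a' ∧ t = t') ∨ (t = 1 ∧ t' = 0) ∨ t = 0 ∧ t' = 1
  arc_ne_loop : ∀ a t l u, S.arc a t ≠ S.loop l u
  loop_eq : ∀ {l u l' u'}, S.loop l u = S.loop l' u' → l = l' ∧ u = u'

variable {S}

theorem WeaklyEmbedded.start_injective (h : S.WeaklyEmbedded) {a a' : A}
    (e : S.arc a 0 = S.arc a' 0) : a = a' := by
  rcases h.arc_eq e with h | h | h
  · exact h.1
  · exact absurd h.1 zero_ne_one
  · exact absurd h.2 zero_ne_one

theorem WeaklyEmbedded.end_injective (h : S.WeaklyEmbedded) {a a' : A}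
    (e : S.arc a 1 = S.arc a' 1) : a = a' := by
  rcases h.arc_eq e with h | h | h
  · exact h.1
  · exact absurd h.2 one_ne_zero
  · exact absurd h.1 one_ne_zero

variable (S)

/-- The beginning points of the intervals. -/
def starts : Set ℂ := Set.range fun a => S.arc a 0

/-- The ending points of the intervals. -/
def ends : Set ℂ := Set.range fun a => S.arc a 1

/-- `S'` results from `S` by gluing some of the intervals end to end. -/
structure GluesTo (S' : Strands A' Λ') : Prop where
  support_eq : S'.support = S.support
  path : ∀ {γ}, S.IsPositivePath γ → S'.IsPositivePath γ
  starts_eq : S'.starts \ S'.ends = S.starts \ S.ends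
  ends_eq : S'.ends \ S'.starts = S.ends \ S.starts

theorem GluesTo.trans {A'' Λ'' : Type} {S : Strands A Λ} {S' : Strands A' Λ'}
    {S'' : Strands A'' Λ''} (h : S.GluesTo S') (h' : S'.GluesTo S'') : S.GluesTo S'' :=
  ⟨h'.1.trans h.1, fun hγ => h'.2 (h.2 hγ), h'.3.trans h.3, h'.4.trans h.4⟩

/-- The junction `p` is both a beginning and an end, so neither difference contains it before the
gluing, and deleting it from both sets leaves the differences unchanged. -/
theorem gluesTo_of_diff {S : Strands A Λ} {S' : Strands A' Λ'} {p : ℂ}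
    (hsupp : S'.support = S.support) (hpath : ∀ {γ}, S.IsPositivePath γ → S'.IsPositivePath γ)
    (hs : p ∈ S.starts) (he : p ∈ S.ends)
    (hs' : S'.starts = S.starts \ {p}) (he' : S'.ends = S.ends \ {p}) : S.GluesTo S' := by
  refine ⟨hsupp, hpath, ?_, ?_⟩
  · rw [hs', he']
    ext x
    simp only [Set.mem_sdiff, Set.mem_singleton_iff]
    grind
  · rw [hs', he']
    ext x
    simp only [Set.mem_sdiff, Set.mem_singleton_iff]
    grind

/-- An interval that ends where it begins becomes a circle. -/
theorem WeaklyEmbedded.close {S : Strands A Λ} (h : S.WeaklyEmbedded) {a : A}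
    (ha : S.arc a 1 = S.arc a 0) :
    ∃ S' : Strands {x // x ≠ a} (Option Λ), S'.WeaklyEmbedded ∧ S.GluesTo S' := by
  obtain ⟨l, hl⟩ := exists_closed_loop (S.arc a) ha.symm
  let S' : Strands {x // x ≠ a} (Option Λ) := ⟨fun x => S.arc x.1, fun o => o.elim l S.loop⟩
  -- Both ends of `a` are the same point. Another interval through it would share a beginning or an
  -- end with `a`.
  have hne : ∀ x : {x // x ≠ a}, ∀ t u, S.arc x.1 t ≠ S.arc a u := by
    intro x t u e
    rcases h.arc_eq e with e' | ⟨rfl, rfl⟩ | ⟨rfl, rfl⟩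
    · exact x.2 e'.1
    · exact x.2 (h.end_injective (e.trans ha.symm))
    · exact x.2 (h.start_injective (e.trans ha))
  refine ⟨S', ⟨?_, ?_, ?_⟩, gluesTo_of_diff (p := S.arc a 1) ?_ ?_ ⟨a, ha.symm⟩ ⟨a, rfl⟩ ?_ ?_⟩
  · intro x t x' t' e
    rcases h.arc_eq e with e' | e'
    · exact .inl ⟨Subtype.ext e'.1, e'.2⟩
    · exact .inr e'
  · rintro x t (_ | m) u e
    · obtain ⟨v, -, rfl⟩ := exists_unitInterval_coe u
      exact hne x t v (e.trans (hl v))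
    · exact h.arc_ne_loop _ _ _ _ e
  · rintro (_ | m) u (_ | m') u' e
    · obtain ⟨v, hv, rfl⟩ := exists_unitInterval_coe u
      obtain ⟨v', hv', rfl⟩ := exists_unitInterval_coe u'
      have : S.arc a v = S.arc a v' := (hl v).symm.trans (Eq.trans e (hl v'))
      rcases h.arc_eq this with e' | e' | e'
      · exact ⟨rfl, by rw [e'.2]⟩
      · exact absurd e'.1 hv
      · exact absurd e'.2 hv'
    · obtain ⟨v, hv, rfl⟩ := exists_unitInterval_coe u
      exact absurd ((hl v).symm.trans e) (h.arc_ne_loop _ _ _ _)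
    · obtain ⟨v, hv, rfl⟩ := exists_unitInterval_coe u'
      exact absurd ((hl v).symm.trans e.symm) (h.arc_ne_loop _ _ _ _)
    · exact ⟨congrArg some (h.loop_eq e).1, (h.loop_eq e).2⟩
  · ext z
    simp only [support, Set.mem_union, Set.mem_iUnion, Set.mem_range]
    constructor
    · rintro (⟨x, t, rfl⟩ | ⟨_ | m, u, rfl⟩)
      · exact .inl ⟨x.1, t, rfl⟩
      · obtain ⟨v, hv, rfl⟩ := exists_unitInterval_coe u
        exact .inl ⟨a, v, (hl v).symm⟩
      · exact .inr ⟨m, u, rfl⟩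
    · rintro (⟨x, t, rfl⟩ | ⟨m, u, rfl⟩)
      · by_cases hx : x = a
        · subst hx
          exact .inr ⟨none, _, hl t⟩
        · exact .inl ⟨⟨x, hx⟩, t, rfl⟩
      · exact .inr ⟨some m, u, rfl⟩
  · rintro γ (⟨x, φ, h1, h2, h3⟩ | ⟨m, φ, h1, h2, h3⟩)
    · by_cases hx : x = a
      · subst hx
        exact .inr ⟨none, fun t => φ t, fun _ _ ht => h1 ht, by fun_prop, fun t => by
          rw [h3]; exact (hl _).symm⟩
      · exact .inl ⟨⟨x, hx⟩, φ, h1, h2, h3⟩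
    · exact .inr ⟨some m, φ, h1, h2, h3⟩
  · ext z
    constructor
    · rintro ⟨x, rfl⟩
      exact ⟨⟨x.1, rfl⟩, fun e => hne x _ _ e⟩
    · rintro ⟨⟨x, rfl⟩, hx⟩
      exact ⟨⟨x, fun e => hx (by subst e; exact ha.symm)⟩, rfl⟩
  · ext z
    constructor
    · rintro ⟨x, rfl⟩
      exact ⟨⟨x.1, rfl⟩, fun e => hne x _ _ e⟩
    · rintro ⟨⟨x, rfl⟩, hx⟩
      exact ⟨⟨x, fun e => hx (by subst e; rfl)⟩, rfl⟩

/-- Two intervals, the second of which begins where the first one ends, become one. -/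
theorem WeaklyEmbedded.concat {S : Strands A Λ} (h : S.WeaklyEmbedded) {a b : A} (hab : a ≠ b)
    (hglue : S.arc a 1 = S.arc b 0) :
    ∃ S' : Strands {x // x ≠ b} Λ, S'.WeaklyEmbedded ∧ S.GluesTo S' := by
  classical
  obtain ⟨d, hd1, hd2⟩ := exists_concat _ _ hglue
  let S' : Strands {x // x ≠ b} Λ := ⟨fun x => if x.1 = a then d else S.arc x.1, S.loop⟩
  -- The concatenated interval keeps the index `a`; a point of it comes from `a` or from `b`
  -- according to the half in which its parameter lies.
  have harc : ∀ x : {x // x ≠ b}, ∀ t, (∃ u, t = firstHalf u ∧ x.1 = a ∧ S'.arc x t = S.arc a u) ∨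
      (∃ u, t = secondHalf u ∧ x.1 = a ∧ S'.arc x t = S.arc b u) ∨
      (x.1 ≠ a ∧ S'.arc x t = S.arc x.1 t) := by
    intro x t
    by_cases hx : x.1 = a
    · rcases eq_firstHalf_or_secondHalf t with ⟨u, rfl⟩ | ⟨u, rfl⟩
      · exact .inl ⟨u, rfl, hx, by simp only [S', if_pos hx, hd1]⟩
      · exact .inr (.inl ⟨u, rfl, hx, by simp only [S', if_pos hx, hd2]⟩)
    · exact .inr (.inr ⟨hx, by simp only [S', if_neg hx]⟩)
  have hSa : S'.arc ⟨a, hab⟩ = d := by simp only [S', if_true]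
  have hS0 : ∀ x, S'.arc x 0 = S.arc x.1 0 := by
    intro x
    by_cases hx : x.1 = a
    · simp only [S', if_pos hx]
      rw [← firstHalf_zero, hd1, hx]; rw [firstHalf_zero]
    · simp only [S', if_neg hx]
  have hS1 : ∀ x, S'.arc x 1 = if x.1 = a then S.arc b 1 else S.arc x.1 1 := by
    intro x
    by_cases hx : x.1 = a
    · simp only [S', if_pos hx]
      conv_lhs => rw [← secondHalf_one]
      rw [hd2]
    · simp only [S', if_neg hx]
  refine ⟨S', ⟨?_, ?_, ?_⟩, gluesTo_of_diff (p := S.arc a 1) ?_ ?_ ⟨b, hglue.symm⟩ ⟨a, rfl⟩ ?_ ?_⟩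
  -- A third interval can no longer touch the junction, which is already taken as an end by `a` and
  -- as a beginning by `b`. It can only meet the free ends: the beginning of `a` and the end of `b`.
  · have key : ∀ (x y : {x // x ≠ b}) (u v : I), x.1 = a → y.1 ≠ a →
        (S.arc a u = S.arc y.1 v → u = 0 ∧ v = 1) ∧ (S.arc b u = S.arc y.1 v → u = 1 ∧ v = 0) := by
      intro x y u v hx hy
      constructor
      · intro e
        rcases h.arc_eq e with e' | ⟨rfl, rfl⟩ | e'
        · exact absurd e'.1.symm hy
        · exact absurd (h.start_injective (e.symm.trans hglue)) y.2
        · exact e'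
      · intro e
        rcases h.arc_eq e with e' | e' | ⟨rfl, rfl⟩
        · exact absurd e'.1.symm y.2
        · exact e'
        · exact absurd (h.end_injective (e.symm.trans hglue.symm)) hy
    -- Either this is the junction, which has one parameter in the new interval, or `b` also ends
    -- where `a` begins, and the new interval can be closed later.
    have key2 : ∀ u v, S.arc a u = S.arc b v → firstHalf u = secondHalf v ∨
        firstHalf u = 0 ∧ secondHalf v = 1 := by
      intro u v e
      rcases h.arc_eq e with e' | ⟨rfl, rfl⟩ | ⟨rfl, rfl⟩
      · exact absurd e'.1 hab
      · exact .inl firstHalf_one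
      · exact .inr ⟨firstHalf_zero, secondHalf_one⟩
    intro x t y t' e
    rcases harc x t with ⟨u, rfl, hx, e1⟩ | ⟨u, rfl, hx, e1⟩ | ⟨hx, e1⟩ <;>
      rcases harc y t' with ⟨v, rfl, hy, e2⟩ | ⟨v, rfl, hy, e2⟩ | ⟨hy, e2⟩ <;>
      rw [e1, e2] at e
    · rcases h.arc_eq e with e' | ⟨rfl, rfl⟩ | ⟨rfl, rfl⟩
      · exact .inl ⟨Subtype.ext (hx.trans hy.symm), by rw [e'.2]⟩
      · exact absurd (h.start_injective (e.symm.trans hglue)) hab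
      · exact absurd (h.start_injective (e.trans hglue)) hab
    · rcases key2 _ _ e with e' | e'
      · exact .inl ⟨Subtype.ext (hx.trans hy.symm), e'⟩
      · exact .inr (.inr e')
    · obtain ⟨rfl, rfl⟩ := (key x y u t' hx hy).1 e
      exact .inr (.inr ⟨firstHalf_zero, rfl⟩)
    · rcases key2 _ _ e.symm with e' | e'
      · exact .inl ⟨Subtype.ext (hx.trans hy.symm), e'.symm⟩
      · exact .inr (.inl e'.symm)
    · rcases h.arc_eq e with e' | ⟨rfl, rfl⟩ | ⟨rfl, rfl⟩
      · exact .inl ⟨Subtype.ext (hx.trans hy.symm), by rw [e'.2]⟩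
      · exact absurd (h.end_injective (hglue.trans e.symm)) hab
      · exact absurd (h.end_injective (hglue.trans e)) hab
    · obtain ⟨rfl, rfl⟩ := (key x y u t' hx hy).2 e
      exact .inr (.inl ⟨secondHalf_one, rfl⟩)
    · obtain ⟨rfl, rfl⟩ := (key y x v t hy hx).1 e.symm
      exact .inr (.inl ⟨rfl, firstHalf_zero⟩)
    · obtain ⟨rfl, rfl⟩ := (key y x v t hy hx).2 e.symm
      exact .inr (.inr ⟨rfl, secondHalf_one⟩)
    · rcases h.arc_eq e with e' | e'
      · exact .inl ⟨Subtype.ext e'.1, e'.2⟩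
      · exact .inr e'
  · intro x t l u e
    rcases harc x t with ⟨v, rfl, hx, e1⟩ | ⟨v, rfl, hx, e1⟩ | ⟨hx, e1⟩ <;>
      exact h.arc_ne_loop _ _ _ _ (e1.symm.trans e)
  · exact fun e => h.loop_eq e
  · ext z
    simp only [support, Set.mem_union, Set.mem_iUnion, Set.mem_range]
    constructor
    · rintro (⟨x, t, rfl⟩ | hz)
      · rcases harc x t with ⟨v, rfl, hx, e1⟩ | ⟨v, rfl, hx, e1⟩ | ⟨hx, e1⟩ <;>
          exact .inl ⟨_, _, e1.symm⟩
      · exact .inr hz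
    · rintro (⟨x, t, rfl⟩ | hz)
      · by_cases hxa : x = a
        · subst hxa
          exact .inl ⟨⟨x, hab⟩, firstHalf t, by rw [hSa, hd1]⟩
        · by_cases hxb : x = b
          · subst hxb
            exact .inl ⟨⟨a, hab⟩, secondHalf t, by rw [hSa, hd2]⟩
          · exact .inl ⟨⟨x, hxb⟩, t, by simp only [S', if_neg hxa]⟩
      · exact .inr hz
  · rintro γ (⟨x, φ, h1, h2, h3⟩ | hγ)
    · by_cases hxa : x = a
      · subst hxa
        exact .inl ⟨⟨x, hab⟩, firstHalf ∘ φ, firstHalf_strictMono.comp h1,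
          continuous_firstHalf.comp h2, fun t => by rw [hSa, h3, Function.comp, hd1]⟩
      · by_cases hxb : x = b
        · subst hxb
          exact .inl ⟨⟨a, hab⟩, secondHalf ∘ φ, secondHalf_strictMono.comp h1,
            continuous_secondHalf.comp h2, fun t => by rw [hSa, h3, Function.comp, hd2]⟩
        · exact .inl ⟨⟨x, hxb⟩, φ, h1, h2, fun t => by simp only [S', if_neg hxa, h3]⟩
    · exact .inr hγ
  · ext z
    constructor
    · rintro ⟨x, rfl⟩
      exact ⟨⟨x.1, (hS0 x).symm⟩, fun e => x.2
        (h.start_injective ((hS0 x).symm.trans (Eq.trans e hglue)))⟩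
    · rintro ⟨⟨x, rfl⟩, hx⟩
      exact ⟨⟨x, fun e => hx (by subst e; exact hglue.symm)⟩, hS0 _⟩
  · ext z
    constructor
    · rintro ⟨x, rfl⟩
      by_cases hx : x.1 = a
      · refine ⟨⟨b, by simp only [hS1, if_pos hx]⟩, fun e => ?_⟩
        simp only [hS1, if_pos hx] at e
        exact hab (h.end_injective e).symm
      · refine ⟨⟨x.1, by simp only [hS1, if_neg hx]⟩, fun e => ?_⟩
        simp only [hS1, if_neg hx] at e
        exact hx (h.end_injective e)
    · rintro ⟨⟨x, rfl⟩, hx⟩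
      by_cases hxb : x = b
      · exact ⟨⟨a, hab⟩, by simp only [hS1, if_true, hxb]⟩
      · have hxa : x ≠ a := fun e => hx (by subst e; rfl)
        exact ⟨⟨x, hxb⟩, by simp only [hS1, if_neg hxa]⟩

/-- Everything that can be glued can be glued. -/
theorem WeaklyEmbedded.exists_embedded {A Λ : Type} [Finite A] [Finite Λ] {S : Strands A Λ}
    (h : S.WeaklyEmbedded) :
    ∃ (A' : Type) (n : ℕ) (S' : Strands A' (Fin n)), S'.Embedded ∧ S.GluesTo S' := by
  -- Either kind of gluing uses up one interval. The index types change with every gluing, so they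
  -- are generalized.
  induction hn : Nat.card A using Nat.strong_induction_on generalizing A Λ with
  | _ n ih =>
  by_cases hglue : ∃ a b, S.arc a 1 = S.arc b 0
  · obtain ⟨a, b, hab⟩ := hglue
    have hlt : ∀ c : A, Nat.card {x // x ≠ c} < n := by
      intro c
      rw [← hn]
      exact Finite.card_subtype_lt (x := c) (by simp)
    by_cases e : a = b
    · subst e
      obtain ⟨S₁, h₁, h₁'⟩ := h.close hab
      obtain ⟨A', m, S', h₂, h₂'⟩ := ih _ (hlt a) h₁ rfl
      exact ⟨A', m, S', h₂, h₁'.trans h₂'⟩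
    · obtain ⟨S₁, h₁, h₁'⟩ := h.concat e hab
      obtain ⟨A', m, S', h₂, h₂'⟩ := ih _ (hlt b) h₁ rfl
      exact ⟨A', m, S', h₂, h₁'.trans h₂'⟩
  -- Without junctions the exceptional cases of weak embeddedness do not occur; it remains to number
  -- the circles.
  · obtain ⟨m, ⟨f⟩⟩ := Finite.exists_equiv_fin Λ
    refine ⟨A, m, ⟨S.arc, S.loop ∘ f.symm⟩, ⟨?_, ?_, ?_⟩, ?_, ?_, rfl, rfl⟩
    · intro a t a' t' e
      rcases h.arc_eq e with e' | ⟨rfl, rfl⟩ | ⟨rfl, rfl⟩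
      · exact e'
      · exact absurd ⟨_, _, e⟩ hglue
      · exact absurd ⟨_, _, e.symm⟩ hglue
    · exact fun a t l u => h.arc_ne_loop a t _ u
    · exact fun e => ⟨f.symm.injective (h.loop_eq e).1, (h.loop_eq e).2⟩
    · unfold support
      congr 1
      exact f.symm.surjective.iUnion_comp fun l => Set.range (S.loop l)
    · rintro γ (hγ | ⟨l, hγ⟩)
      · exact .inl hγ
      · exact .inr ⟨f l, by simpa using hγ⟩

end Strands

/-! ### Connected components of glued strands -/

/-- A preconnected set covered by finitely many disjoint closed sets lies in one of them. -/
theorem IsPreconnected.exists_subset_of_finite_closed_cover {ι : Type} [Finite ι] {K : Set ℂ}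
    (hK : IsPreconnected K) (hne : K.Nonempty) {C : ι → Set ℂ} (hC : ∀ i, IsClosed (C i))
    (hdisj : ∀ i j z, z ∈ C i → z ∈ C j → i = j) (hcov : K ⊆ ⋃ i, C i) : ∃ i, K ⊆ C i := by
  obtain ⟨z, hz⟩ := hne
  obtain ⟨i, hi⟩ := Set.mem_iUnion.mp (hcov hz)
  refine ⟨i, ?_⟩
  have hclosed : IsClosed (⋃ j : {j // j ≠ i}, C j.1) := isClosed_iUnion_of_finite fun j => hC j.1
  have hint : ∀ x, x ∈ C i → x ∉ ⋃ j : {j // j ≠ i}, C j.1 := by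
    intro x hx hx'
    obtain ⟨j, hj⟩ := Set.mem_iUnion.mp hx'
    exact j.2 (hdisj _ _ _ hj hx)
  have hunion : K ⊆ C i ∪ ⋃ j : {j // j ≠ i}, C j.1 := by
    intro x hx
    obtain ⟨j, hj⟩ := Set.mem_iUnion.mp (hcov hx)
    by_cases e : j = i
    · subst e; exact .inl hj
    · exact .inr (Set.mem_iUnion.mpr ⟨⟨j, e⟩, hj⟩)
  have hempty : K ∩ (C i ∩ ⋃ j : {j // j ≠ i}, C j.1) = ∅ := by
    rw [Set.eq_empty_iff_forall_notMem]
    exact fun x hx => hint x hx.2.1 hx.2.2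
  rcases isPreconnected_iff_subset_of_disjoint_closed.mp hK _ _ (hC i) hclosed hunion hempty
    with h | h
  · exact h
  · exact absurd (h hz) (hint z hi)

namespace Strands

variable {A Λ A' Λ' : Type} {S : Strands A Λ}

/-- The component of the union of the strands which is given by an interval or a circle. -/
def strand (S : Strands A Λ) (c : A ⊕ Λ) : Set ℂ :=
  c.elim (fun a => Set.range (S.arc a)) fun l => Set.range (S.loop l)

theorem support_eq_iUnion_strand : S.support = ⋃ c, S.strand c := by
  rw [Set.iUnion_sum]
  rfl

theorem strand_nonempty (c : A ⊕ Λ) : (S.strand c).Nonempty := by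
  rcases c with a | l
  · exact Set.range_nonempty _
  · exact Set.range_nonempty _

theorem isPreconnected_strand (c : A ⊕ Λ) : IsPreconnected (S.strand c) := by
  rcases c with a | l
  · exact isPreconnected_range (S.arc a).continuous
  · exact isPreconnected_range (S.loop l).continuous

theorem Embedded.strand_unique (h : S.Embedded) {c c' : A ⊕ Λ} {z : ℂ} (hz : z ∈ S.strand c)
    (hz' : z ∈ S.strand c') : c = c' := by
  rcases c with a | l <;> rcases c' with a' | l' <;>
    obtain ⟨t, rfl⟩ := hz <;> obtain ⟨t', e⟩ := hz'
  · rw [(h.arc_eq e).1]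
  · exact absurd e.symm (h.arc_ne_loop _ _ _ _)
  · exact absurd e (h.arc_ne_loop _ _ _ _)
  · rw [(h.loop_eq e).1]

theorem IsPositivePath.exists_strand {γ : I → ℂ} (h : S.IsPositivePath γ) :
    ∃ c, ∀ t, γ t ∈ S.strand c := by
  rcases h with ⟨a, φ, -, -, h⟩ | ⟨l, φ, -, -, h⟩
  · exact ⟨.inl a, fun t => ⟨φ t, (h t).symm⟩⟩
  · exact ⟨.inr l, fun t => ⟨_, (h t).symm⟩⟩

/-- A positive path in an embedded interval advances along it. -/
theorem Embedded.advance (h : S.Embedded) {γ : I → ℂ} (hγ : S.IsPositivePath γ) {a : A}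
    (ha : ∃ t, γ t ∈ Set.range (S.arc a)) : ∃ u v, u < v ∧ γ 0 = S.arc a u ∧ γ 1 = S.arc a v := by
  obtain ⟨t, u, hu⟩ := ha
  rcases hγ with ⟨a', φ, h1, -, h2⟩ | ⟨l, φ, -, -, h2⟩
  · rw [h2] at hu
    obtain rfl := (h.arc_eq hu).1
    exact ⟨φ 0, φ 1, h1 zero_lt_one, h2 0, h2 1⟩
  · rw [h2] at hu
    exact absurd hu (h.arc_ne_loop _ _ _ _)

section Components

variable {X Y G : Type} {q : X ⊕ G ≃ Y ⊕ G}

/-- A connected component of the glued intervals and circles. -/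
def glued (S : Strands (X ⊕ G) Λ) (q : X ⊕ G ≃ Y ⊕ G) (K : Quot (GlueStep q) ⊕ Λ) : Set ℂ :=
  K.elim (fun K => ⋃ z : {z // Quot.mk _ z = K}, Set.range (S.arc z.1))
    fun l => Set.range (S.loop l)

/-- `glueCircles` counts classes of glued points only, and this compares them with classes of all
pieces. A step never leads into `X`, and an element of `X` has at most one successor, so sending it
to the class of its successor (`none` if it has none) is constant along steps and retracts onto the
classes of glued points. -/
theorem quot_inr_injective {g g' : G}
    (h : Quot.mk (GlueStep q) (.inr g) = Quot.mk (GlueStep q) (.inr g')) :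
    Quot.mk (fun g g' : G => q (Sum.inr g) = Sum.inr g') g = Quot.mk _ g' := by
  let r : X ⊕ G → Option (Quot fun g g' : G => q (Sum.inr g) = Sum.inr g') := fun z =>
    z.elim (fun x => (q (.inl x)).elim (fun _ => none) fun g => some (Quot.mk _ g))
      fun g => some (Quot.mk _ g)
  have hr : ∀ z z', GlueStep q z z' → r z = r z' := by
    rintro (x | g) _ ⟨g', hg, rfl⟩
    · simp [r, hg]
    · exact congrArg some (Quot.sound hg)
  have := congrArg (Quot.lift r hr) h
  exact Option.some_injective _ this

variable [Finite G]

/-- A component that contains no free ending point consists of glued points. -/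
theorem exists_inr_of_cyclic {z : X ⊕ G}
    (hz : ∀ z', Quot.mk (GlueStep q) z' = Quot.mk _ z → ∀ y, q z' ≠ .inl y) : ∃ g, z = .inr g := by
  rcases z with x | g
  · obtain ⟨y, z, hxz, hy⟩ := glueLeads_exists q x
    refine absurd hy (hz z ?_ y)
    clear hy hz
    induction hxz with
    | refl => rfl
    | tail _ h ih => rw [← ih, Quot.sound h]
  · exact ⟨g, rfl⟩

/-- The components of the union of the strands, seen from the pieces of which they consist and from
the glued strands. -/
theorem exists_glued_equiv [Finite X] [Finite Λ] {S : Strands (X ⊕ G) Λ} {S' : Strands A' Λ'}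
    (hS : S.WeaklyEmbedded) (hS' : S'.Embedded)
    (hnext : ∀ z z', S.arc z 1 = S.arc z' 0 ↔ GlueStep q z z')
    (hpath : ∀ γ, S.IsPositivePath γ → S'.IsPositivePath γ) (hsupp : S'.support = S.support) :
    ∃ τ : Quot (GlueStep q) ⊕ Λ ≃ A' ⊕ Λ', ∀ K, S.glued q K ⊆ S'.strand (τ K) := by
  have hfin : Finite (Quot (GlueStep q)) := Finite.of_surjective _ Quot.mk_surjective
  have h1 : ∀ z, ∃ c, ∀ t, S.arc z t ∈ S'.strand c := fun z =>
    (hpath _ (S.isPositivePath_arc z)).exists_strand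
  choose κ hκ using h1
  have h2 : ∀ l, ∃ c, ∀ t : I, S.loop l ((t : ℝ) : UnitAddCircle) ∈ S'.strand c := fun l =>
    (hpath _ (S.isPositivePath_loop l)).exists_strand
  choose μ hμ using h2
  -- Consecutive pieces share a point, and the strands of `S'` are disjoint.
  have hstep : ∀ z z', GlueStep q z z' → κ z = κ z' := fun z z' h => by
    have := hκ z 1
    rw [(hnext z z').mpr h] at this
    exact hS'.strand_unique this (hκ z' 0)
  let τ : Quot (GlueStep q) ⊕ Λ → A' ⊕ Λ' := Sum.elim (Quot.lift κ hstep) μ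
  have hτ : ∀ K, S.glued q K ⊆ S'.strand (τ K) := by
    rintro (K | l)
    · refine Set.iUnion_subset ?_
      rintro ⟨z, rfl⟩ _ ⟨t, rfl⟩
      exact hκ z t
    · rintro _ ⟨u, rfl⟩
      obtain ⟨t, -, rfl⟩ := exists_unitInterval_coe u
      exact hμ l t
  have hne : ∀ K, (S.glued q K).Nonempty := by
    rintro (K | l)
    · obtain ⟨z, rfl⟩ := Quot.mk_surjective K
      exact ⟨S.arc z 0, Set.mem_iUnion.mpr ⟨⟨z, rfl⟩, 0, rfl⟩⟩
    · exact Set.range_nonempty _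
  have hclosed : ∀ K, IsClosed (S.glued q K) := by
    rintro (K | l)
    · have : Finite {z // Quot.mk (GlueStep q) z = K} := inferInstance
      exact isClosed_iUnion_of_finite fun z => (isCompact_range (S.arc z.1).continuous).isClosed
    · exact (isCompact_range (S.loop l).continuous).isClosed
  -- By weak embeddedness, distinct pieces that meet do so at a junction, and then they are
  -- consecutive and belong to the same class.
  have hdisj : ∀ K K' z, z ∈ S.glued q K → z ∈ S.glued q K' → K = K' := by
    have key : ∀ (z : X ⊕ G) l t u, S.arc z t ≠ S.loop l u := fun z l t u => hS.arc_ne_loop _ _ _ _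
    rintro (K | l) (K' | l') z hz hz'
    · obtain ⟨⟨w, rfl⟩, t, rfl⟩ := Set.mem_iUnion.mp hz
      obtain ⟨⟨w', rfl⟩, t', e⟩ := Set.mem_iUnion.mp hz'
      rcases hS.arc_eq e with ⟨rfl, -⟩ | ⟨rfl, rfl⟩ | ⟨rfl, rfl⟩
      · rfl
      · rw [Quot.sound ((hnext _ _).mp e)]
      · rw [Quot.sound ((hnext _ _).mp e.symm)]
    · obtain ⟨⟨w, rfl⟩, t, rfl⟩ := Set.mem_iUnion.mp hz
      obtain ⟨u, e⟩ := hz'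
      exact absurd e.symm (key _ _ _ _)
    · obtain ⟨⟨w, rfl⟩, t, rfl⟩ := Set.mem_iUnion.mp hz'
      obtain ⟨u, e⟩ := hz
      exact absurd e.symm (key _ _ _ _)
    · obtain ⟨u, rfl⟩ := hz
      obtain ⟨u', e⟩ := hz'
      rw [(hS.loop_eq e).1]
  -- A strand of `S'` is connected and is covered by the finitely many disjoint closed sets `glued`.
  have hback : ∀ c, ∃ K, S'.strand c ⊆ S.glued q K := by
    intro c
    refine (isPreconnected_strand c).exists_subset_of_finite_closed_cover (strand_nonempty c)
      hclosed hdisj ?_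
    refine (Set.subset_iUnion S'.strand c).trans ?_
    rw [← support_eq_iUnion_strand, hsupp]
    rintro _ (h | h)
    · obtain ⟨z, hz⟩ := Set.mem_iUnion.mp h
      exact Set.mem_iUnion.mpr ⟨.inl (Quot.mk _ z), Set.mem_iUnion.mpr ⟨⟨z, rfl⟩, hz⟩⟩
    · obtain ⟨l, hl⟩ := Set.mem_iUnion.mp h
      exact Set.mem_iUnion.mpr ⟨.inr l, hl⟩
  choose ρ hρ using hback
  -- The inclusions in both directions, between nonempty members of disjoint families, make `τ` and
  -- `ρ` mutually inverse.
  refine ⟨⟨τ, ρ, fun K => ?_, fun c => ?_⟩, hτ⟩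
  · obtain ⟨z, hz⟩ := hne K
    exact hdisj _ _ z (hρ _ (hτ K hz)) hz
  · obtain ⟨z, hz⟩ := strand_nonempty (S := S') c
    exact hS'.strand_unique (hτ _ (hρ c hz)) hz

/-- The number of circles that result from a gluing of embedded intervals. -/
theorem card_loops_of_glued [Finite X] [Finite Λ] {S : Strands (X ⊕ G) Λ} {S' : Strands A' Λ'}
    (hS : S.WeaklyEmbedded) (hS' : S'.Embedded)
    (hnext : ∀ z z', S.arc z 1 = S.arc z' 0 ↔ GlueStep q z z')
    (hpath : ∀ γ, S.IsPositivePath γ → S'.IsPositivePath γ) (hsupp : S'.support = S.support)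
    (hend : ∀ z y, q z = .inl y → ∃ a, S'.arc a 1 = S.arc z 1) :
    Nat.card Λ' = Nat.card Λ + glueCircles q := by
  obtain ⟨τ, hτ⟩ := exists_glued_equiv hS hS' hnext hpath hsupp
  have harc : ∀ z t, S.arc z t ∈ S'.strand (τ (.inl (Quot.mk _ z))) := fun z t =>
    hτ _ (Set.mem_iUnion.mpr ⟨⟨z, rfl⟩, t, rfl⟩)
  -- Running once around a loop returns to the starting point, whereas a positive path in an
  -- interval ends strictly later.
  have hloop : ∀ l, ∃ l', τ (.inr l) = .inr l' := by
    intro l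
    rcases e : τ (.inr l) with a | l'
    · have h0 : S.loop l ((0 : ℝ) : UnitAddCircle) ∈ Set.range (S'.arc a) := by
        have := hτ (.inr l) ⟨((0 : ℝ) : UnitAddCircle), rfl⟩
        rwa [e] at this
      obtain ⟨u, v, huv, h1, h2⟩ := hS'.advance (hpath _ (S.isPositivePath_loop l)) ⟨0, h0⟩
      simp only [Set.Icc.coe_zero, Set.Icc.coe_one, unitAddCircle_coe_one] at h1 h2
      exact absurd (hS'.arc_eq (h1.symm.trans h2)).2 huv.ne
    · exact ⟨l', rfl⟩
  choose μ hμ using hloop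
  -- If the class lay in an interval, take the piece that begins furthest along it. It has a
  -- successor in the class, which begins where the piece ends, hence still further along.
  have hcyc : ∀ K, (∀ z, Quot.mk _ z = K → ∀ y, q z ≠ .inl y) → ∃ l', τ (.inl K) = .inr l' := by
    intro K hK
    rcases e : τ (.inl K) with a | l'
    · exfalso
      have hadv : ∀ z : {z // Quot.mk (GlueStep q) z = K},
          ∃ u v, u < v ∧ S.arc z.1 0 = S'.arc a u ∧ S.arc z.1 1 = S'.arc a v := by
        rintro ⟨z, rfl⟩
        refine hS'.advance (hpath _ (S.isPositivePath_arc z)) ⟨0, ?_⟩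
        have := harc z 0
        rwa [e] at this
      choose u v huv hu hv using hadv
      obtain ⟨z₀, hz₀⟩ := Quot.mk_surjective K
      have : Nonempty {z // Quot.mk (GlueStep q) z = K} := ⟨z₀, hz₀⟩
      obtain ⟨z, hz⟩ := Finite.exists_max u
      rcases hq : q z.1 with y | g
      · exact hK _ z.2 y hq
      · have hs : GlueStep q z.1 (.inr g) := ⟨g, hq, rfl⟩
        let z' : {z // Quot.mk (GlueStep q) z = K} := ⟨.inr g, by rw [← Quot.sound hs, z.2]⟩
        have hvu : v z = u z' :=
          (hS'.arc_eq ((hv z).symm.trans (((hnext _ _).mpr hs).trans (hu z')))).2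
        exact absurd (hz z') (not_le.mpr (hvu ▸ huv z))
    · exact ⟨l', rfl⟩
  have hq' : ∀ K : {K : Quot (fun g g' : G => q (Sum.inr g) = Sum.inr g') //
      ∀ g, Quot.mk _ g = K → ∀ y, q (Sum.inr g) ≠ Sum.inl y},
      ∃ g, Quot.mk _ g = K.1 ∧ ∃ l', τ (.inl (Quot.mk _ (.inr g))) = .inr l' := by
    rintro ⟨K, hK⟩
    obtain ⟨g, rfl⟩ := Quot.mk_surjective K
    refine ⟨g, rfl, hcyc _ ?_⟩
    -- a zigzag of glueing steps leads from every member of the component back to `g`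
    have key : ∀ z, Relation.EqvGen (GlueStep q) z (.inr g) → ∀ y, q z ≠ .inl y := by
      rintro (x | g') hz y hy
      -- A piece with free beginning and free end has neither predecessor nor successor, so it is
      -- alone in its class and cannot be related to `g`.
      · let r : X ⊕ G → Prop := fun z => z = .inl x
        have hr : ∀ z z', GlueStep q z z' → (r z ↔ r z') := by
          rintro z _ ⟨g', hg, rfl⟩
          simp only [r, reduceCtorEq, iff_false]
          rintro rfl
          rw [hy] at hg
          cases hg
        have := congrArg (Quot.lift r fun a b h => propext (hr a b h)) (Quot.eqvGen_sound hz)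
        simp [r] at this
      · exact hK g' (quot_inr_injective (Quot.eqvGen_sound hz)) y hy
    exact fun z hz => key z (Quot.eqvGen_exact hz)
  choose g hg ν hν using hq'
  have hbij : Function.Bijective (Sum.elim μ ν) := by
    constructor
    · rintro (l | K) (l' | K') e
      · have := τ.injective ((hμ l).trans ((congrArg Sum.inr e).trans (hμ l').symm))
        rw [Sum.inr_injective this]
      · have := τ.injective ((hμ l).trans ((congrArg Sum.inr e).trans (hν K').symm))
        cases this
      · have := τ.injective ((hν K).trans ((congrArg Sum.inr e).trans (hμ l').symm))
        cases this
      · have := τ.injective ((hν K).trans ((congrArg Sum.inr e).trans (hν K').symm))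
        congr 1
        apply Subtype.ext
        rw [← hg, ← hg]
        exact quot_inr_injective (Sum.inl_injective this)
    · intro l'
      obtain ⟨K | l, hK⟩ := τ.surjective (.inr l')
      -- By `hend` a free end of the class would be the end of an interval of `S'`, but the class
      -- lies on a circle.
      · have hfree : ∀ z, Quot.mk _ z = K → ∀ y, q z ≠ .inl y := by
          rintro z rfl y hy
          obtain ⟨a, ha⟩ := hend z y hy
          have h1 : S'.arc a 1 ∈ S'.strand (.inl a) := ⟨1, rfl⟩
          have h2 := harc z 1
          rw [hK, ← ha] at h2
          cases hS'.strand_unique h1 h2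
        obtain ⟨z, rfl⟩ := Quot.mk_surjective K
        obtain ⟨g₀, rfl⟩ := exists_inr_of_cyclic hfree
        let K' : {K : Quot (fun g g' : G => q (Sum.inr g) = Sum.inr g') //
            ∀ g, Quot.mk _ g = K → ∀ y, q (Sum.inr g) ≠ Sum.inl y} := by
          refine ⟨Quot.mk _ g₀, fun g' hg' => hfree _ ?_⟩
          have := congrArg (Quot.lift (fun g => Quot.mk (GlueStep q) (.inr g))
            fun a b h => Quot.sound ⟨b, h, rfl⟩) hg'
          exact this
        refine ⟨.inr K', ?_⟩
        have e : Quot.mk (GlueStep q) (.inr (g K')) = Quot.mk _ (.inr g₀) :=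
          congrArg (Quot.lift (fun g => Quot.mk (GlueStep q) (.inr g))
            fun a b h => Quot.sound ⟨b, h, rfl⟩) (hg K')
        have := hν K'
        rw [e, hK] at this
        exact (Sum.inr_injective this).symm
      · exact ⟨.inl l, Sum.inr_injective ((hμ l).symm.trans hK)⟩
  have hfin : Finite {K : Quot (fun g g' : G => q (Sum.inr g) = Sum.inr g') //
      ∀ g, Quot.mk _ g = K → ∀ y, q (Sum.inr g) ≠ Sum.inl y} := by
    have : Finite (Quot (fun g g' : G => q (Sum.inr g) = Sum.inr g')) :=
      Finite.of_surjective _ Quot.mk_surjective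
    infer_instance
  rw [← Nat.card_congr (Equiv.ofBijective _ hbij), Nat.card_sum]
  rfl

end Components

end Strands

/-! ### Discs with holes -/

namespace HoledDisc

variable {ι κ : Type} (H : HoledDisc ι)

theorem dist_hole (i : ι) (w w' : ℂ) :
    dist (H.hole i w) (H.hole i w') = ‖H.scale i‖ * dist w w' := by
  rw [hole, hole, dist_add_left, dist_eq_norm, dist_eq_norm, ← norm_mul, mul_sub]

theorem dist_hole_center (i : ι) (w : ℂ) : dist (H.hole i w) (H.center i) = ‖H.scale i‖ * ‖w‖ := by
  simp [hole, dist_eq_norm]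

theorem norm_scale_pos (i : ι) : 0 < ‖H.scale i‖ := norm_pos_iff.mpr (H.scale_ne_zero i)

theorem hole_injective (i : ι) : Function.Injective (H.hole i) := fun _ _ h =>
  mul_left_cancel₀ (H.scale_ne_zero i) (add_left_cancel h)

theorem exists_hole_eq (i : ι) (z : ℂ) : ∃ w, H.hole i w = z :=
  ⟨(z - H.center i) / H.scale i, by
    rw [hole, mul_div_cancel₀ _ (H.scale_ne_zero i), add_sub_cancel]⟩

theorem hole_mem_closedBall_iff (i : ι) {w : ℂ} :
    H.hole i w ∈ Metric.closedBall (H.center i) ‖H.scale i‖ ↔ ‖w‖ ≤ 1 := by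
  rw [Metric.mem_closedBall, dist_hole_center]
  exact mul_le_iff_le_one_right (H.norm_scale_pos i)

theorem norm_hole_lt (i : ι) {w : ℂ} (hw : ‖w‖ ≤ 1) : ‖H.hole i w‖ < 1 := by
  simpa using H.hole_subset i ((H.hole_mem_closedBall_iff i).mpr hw)

theorem hole_notMem_interior (i : ι) {w : ℂ} (hw : ‖w‖ ≤ 1) : H.hole i w ∉ H.interior := fun h =>
  absurd (h.2 i) (not_lt.mpr (Metric.mem_closedBall.mp ((H.hole_mem_closedBall_iff i).mpr hw)))

theorem hole_eq_hole {i j : ι} {w w' : ℂ} (hw : ‖w‖ ≤ 1) (hw' : ‖w'‖ ≤ 1)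
    (h : H.hole i w = H.hole j w') : i = j := by
  by_contra hij
  refine Set.disjoint_left.mp (H.hole_disjoint hij) ((H.hole_mem_closedBall_iff i).mpr hw) ?_
  rw [h]
  exact (H.hole_mem_closedBall_iff j).mpr hw'

theorem continuous_hole (i : ι) : Continuous (H.hole i) := by
  unfold hole; fun_prop

/-- A similarity is determined by its values at `0` and `1`. `IsComp` prescribes only these maps,
and this identifies the disc of a composite. -/
theorem ext_of_hole {H H' : HoledDisc ι} (h : ∀ i z, H.hole i z = H'.hole i z) : H = H' := by
  have hc : H.center = H'.center := funext fun i => by simpa [hole] using h i 0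
  have hs : H.scale = H'.scale := funext fun i => by simpa [hole, hc] using h i 1
  cases H
  cases H'
  cases hc
  cases hs
  rfl

/-- The disc with holes that results from placing the disc with holes `H'` into the `i`-th hole of
`H`. -/
def comp (i : ι) (H' : HoledDisc κ) : HoledDisc ({j // j ≠ i} ⊕ κ) where
  center := Sum.elim (fun j => H.center j.1) fun m => H.hole i (H'.center m)
  scale := Sum.elim (fun j => H.scale j.1) fun m => H.scale i * H'.scale m
  scale_ne_zero := by
    rintro (j | m)
    · exact H.scale_ne_zero _
    · exact mul_ne_zero (H.scale_ne_zero _) (H'.scale_ne_zero _)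
  hole_subset := by
    rintro (j | m)
    · exact H.hole_subset _
    · intro z hz
      obtain ⟨w, rfl⟩ := H.exists_hole_eq i z
      rw [Metric.mem_closedBall, Sum.elim_inr, Sum.elim_inr, dist_hole, norm_mul,
        mul_le_mul_iff_right₀ (H.norm_scale_pos i)] at hz
      have := mem_ball_zero_iff.mp (H'.hole_subset m hz)
      exact mem_ball_zero_iff.mpr (H.norm_hole_lt i this.le)
  hole_disjoint := by
    have key : ∀ m w, H.hole i w ∈ Metric.closedBall (H.hole i (H'.center m))
        ‖H.scale i * H'.scale m‖ → w ∈ Metric.closedBall (H'.center m) ‖H'.scale m‖ := by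
      intro m w hw
      rwa [Metric.mem_closedBall, dist_hole, norm_mul,
        mul_le_mul_iff_right₀ (H.norm_scale_pos i)] at hw
    have key2 : ∀ (j : {j // j ≠ i}) m,
        Disjoint (Metric.closedBall (H.center j.1) ‖H.scale j.1‖)
          (Metric.closedBall (H.hole i (H'.center m)) ‖H.scale i * H'.scale m‖) := by
      intro j m
      rw [Set.disjoint_left]
      intro z hz hz'
      obtain ⟨w, rfl⟩ := H.exists_hole_eq i z
      have := mem_ball_zero_iff.mp (H'.hole_subset m (key _ _ hz'))
      exact Set.disjoint_left.mp (H.hole_disjoint j.2) hz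
        ((H.hole_mem_closedBall_iff i).mpr this.le)
    rintro (j | m) (j' | m') hne
    · exact H.hole_disjoint fun h => hne (congrArg _ (Subtype.ext h))
    · exact key2 j m'
    · exact (key2 j' m).symm
    · rw [Set.disjoint_left]
      intro z hz hz'
      obtain ⟨w, rfl⟩ := H.exists_hole_eq i z
      exact Set.disjoint_left.mp (H'.hole_disjoint fun h => hne (congrArg _ h))
        (key _ _ hz) (key _ _ hz')

variable (i : ι) (H' : HoledDisc κ)

theorem comp_hole_inl (j : {j // j ≠ i}) (z : ℂ) :
    (H.comp i H').hole (.inl j) z = H.hole j.1 z := rfl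

theorem comp_hole_inr (m : κ) (z : ℂ) :
    (H.comp i H').hole (.inr m) z = H.hole i (H'.hole m z) := by
  simp only [hole, comp, Sum.elim_inr]
  ring

theorem interior_subset_comp {z : ℂ} (hz : z ∈ H.interior) : z ∈ (H.comp i H').interior := by
  refine ⟨hz.1, ?_⟩
  rintro (j | m)
  · exact hz.2 _
  · by_contra hle
    obtain ⟨w, rfl⟩ := H.exists_hole_eq i z
    simp only [comp, Sum.elim_inr, dist_hole, norm_mul, not_lt,
      mul_le_mul_iff_right₀ (H.norm_scale_pos i)] at hle
    have := mem_ball_zero_iff.mp (H'.hole_subset m (Metric.mem_closedBall.mpr hle))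
    exact H.hole_notMem_interior i this.le hz

theorem hole_mem_comp_interior {w : ℂ} (hw : ‖w‖ ≤ 1)
    (hw' : ∀ m, ‖H'.scale m‖ < dist w (H'.center m)) : H.hole i w ∈ (H.comp i H').interior := by
  refine ⟨H.norm_hole_lt i hw, ?_⟩
  rintro (j | m)
  · by_contra hle
    exact Set.disjoint_left.mp (H.hole_disjoint j.2) (Metric.mem_closedBall.mpr (not_lt.mp hle))
      ((H.hole_mem_closedBall_iff i).mpr hw)
  · simp only [comp, Sum.elim_inr, dist_hole, norm_mul]
    exact mul_lt_mul_of_pos_left (hw' m) (H.norm_scale_pos i)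

theorem hole_interior_subset_comp {w : ℂ} (hw : w ∈ H'.interior) :
    H.hole i w ∈ (H.comp i H').interior :=
  H.hole_mem_comp_interior i H' hw.1.le hw.2

/-- The holes of `H'` stay away from the unit circle, so the circle of gluing avoids all holes of
the composite. Therefore strands may pass through it. -/
theorem hole_circle_subset_comp {w : ℂ} (hw : ‖w‖ = 1) :
    H.hole i w ∈ (H.comp i H').interior := by
  refine H.hole_mem_comp_interior i H' hw.le fun m => ?_
  by_contra hle
  have := mem_ball_zero_iff.mp (H'.hole_subset m (Metric.mem_closedBall.mpr (not_lt.mp hle)))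
  exact this.ne hw

/-! ### Positions of marked points -/

section Marks

variable {s : ι → SignSeq} {s₀ : SignSeq}

/-- Distinct numbered points on the boundary circles have distinct positions. -/
theorem boundary_unique {a b : Fin s₀.len ⊕ Σ i, Fin (s i).len}
    (h : Sum.elim (fun j => markedPoint j) (fun p => H.hole p.1 (markedPoint p.2)) a =
      (Sum.elim (fun j => markedPoint j) (fun p => H.hole p.1 (markedPoint p.2)) b : ℂ)) : a = b := by
  rcases a with j | ⟨i, j⟩ <;> rcases b with j' | ⟨i', j'⟩ <;>
    simp only [Sum.elim_inl, Sum.elim_inr] at h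
  · rw [markedPoint_injective h]
  · have := H.norm_hole_lt i' (norm_markedPoint j').le
    rw [← h, norm_markedPoint] at this
    exact absurd this (lt_irrefl _)
  · have := H.norm_hole_lt i (norm_markedPoint j).le
    rw [h, norm_markedPoint] at this
    exact absurd this (lt_irrefl _)
  · obtain rfl := H.hole_eq_hole (norm_markedPoint j).le (norm_markedPoint j').le h
    rw [markedPoint_injective (H.hole_injective i h)]

theorem beginPoint_injective : Function.Injective (H.beginPoint s s₀) := by
  rintro (j | ⟨i, j⟩) (j' | ⟨i', j'⟩) h
  · exact congrArg Sum.inl (Subtype.ext (Sum.inl_injective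
      (H.boundary_unique (s := s) (a := .inl j.1) (b := .inl j'.1) h)))
  · cases H.boundary_unique (s := s) (a := .inl j.1) (b := .inr ⟨i', j'.1⟩) h
  · cases H.boundary_unique (s := s) (a := .inr ⟨i, j.1⟩) (b := .inl j'.1) h
  · obtain ⟨rfl, h⟩ := Sigma.mk.inj (Sum.inr_injective
      (H.boundary_unique (s := s) (s₀ := s₀) (a := .inr ⟨i, j.1⟩) (b := .inr ⟨i', j'.1⟩) h))
    rw [Subtype.ext (eq_of_heq h)]

theorem endPoint_injective : Function.Injective (H.endPoint s s₀) := by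
  rintro (j | ⟨i, j⟩) (j' | ⟨i', j'⟩) h
  · exact congrArg Sum.inl (Subtype.ext (Sum.inl_injective
      (H.boundary_unique (s := s) (a := .inl j.1) (b := .inl j'.1) h)))
  · cases H.boundary_unique (s := s) (a := .inl j.1) (b := .inr ⟨i', j'.1⟩) h
  · cases H.boundary_unique (s := s) (a := .inr ⟨i, j.1⟩) (b := .inl j'.1) h
  · obtain ⟨rfl, h⟩ := Sigma.mk.inj (Sum.inr_injective
      (H.boundary_unique (s := s) (s₀ := s₀) (a := .inr ⟨i, j.1⟩) (b := .inr ⟨i', j'.1⟩) h))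
    rw [Subtype.ext (eq_of_heq h)]

theorem sign_ne {d : ℕ} {f : Fin d → ℤˣ} {j j' : Fin d} (h : f j = 1) (h' : f j' = -1) :
    j ≠ j' := by
  rintro rfl
  rw [h] at h'
  exact absurd h' (by decide)

/-- The position determines the circle and the number on it, and the sign there decides whether a
strand begins or ends. -/
theorem beginPoint_ne_endPoint (b : BeginMark s s₀) (e : EndMark s s₀) :
    H.beginPoint s s₀ b ≠ H.endPoint s s₀ e := by
  intro h
  rcases b with j | ⟨i, j⟩ <;> rcases e with j' | ⟨i', j'⟩
  · exact sign_ne j.2 j'.2 (Sum.inl_injective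
      (H.boundary_unique (s := s) (a := .inl j.1) (b := .inl j'.1) h))
  · cases H.boundary_unique (s := s) (a := .inl j.1) (b := .inr ⟨i', j'.1⟩) h
  · cases H.boundary_unique (s := s) (a := .inr ⟨i, j.1⟩) (b := .inl j'.1) h
  · obtain ⟨rfl, h⟩ := Sigma.mk.inj (Sum.inr_injective
      (H.boundary_unique (s := s) (s₀ := s₀) (a := .inr ⟨i, j.1⟩) (b := .inr ⟨i', j'.1⟩) h))
    exact sign_ne j'.2 j.2 (eq_of_heq h).symm

theorem beginPoint_notMem_interior (b : BeginMark s s₀) : H.beginPoint s s₀ b ∉ H.interior := by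
  rcases b with j | ⟨i, j⟩
  · exact fun h => absurd h.1 (norm_markedPoint j.1).not_lt
  · exact H.hole_notMem_interior i (norm_markedPoint j.1).le

theorem endPoint_notMem_interior (b : EndMark s s₀) : H.endPoint s s₀ b ∉ H.interior := by
  rcases b with j | ⟨i, j⟩
  · exact fun h => absurd h.1 (norm_markedPoint j.1).not_lt
  · exact H.hole_notMem_interior i (norm_markedPoint j.1).le

theorem norm_beginPoint_le (b : BeginMark s s₀) : ‖H.beginPoint s s₀ b‖ ≤ 1 := by
  rcases b with j | ⟨i, j⟩
  · exact (norm_markedPoint j.1).le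
  · exact (H.norm_hole_lt i (norm_markedPoint j.1).le).le

theorem norm_endPoint_le (b : EndMark s s₀) : ‖H.endPoint s s₀ b‖ ≤ 1 := by
  rcases b with j | ⟨i, j⟩
  · exact (norm_markedPoint j.1).le
  · exact (H.norm_hole_lt i (norm_markedPoint j.1).le).le

variable {i}

theorem beginPoint_eq_hole {b : BeginMark s s₀} {w : ℂ} (hw : ‖w‖ ≤ 1)
    (h : H.beginPoint s s₀ b = H.hole i w) :
    ∃ j : Fin (s i).len, (s i).sign j = -1 ∧ w = markedPoint j := by
  rcases b with j | ⟨i', j⟩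
  · have := H.norm_hole_lt i hw
    rw [← h] at this
    exact absurd this (norm_markedPoint j.1).not_lt
  · obtain rfl := H.hole_eq_hole (norm_markedPoint j.1).le hw h
    exact ⟨j.1, j.2, (H.hole_injective _ h).symm⟩

theorem endPoint_eq_hole {b : EndMark s s₀} {w : ℂ} (hw : ‖w‖ ≤ 1)
    (h : H.endPoint s s₀ b = H.hole i w) :
    ∃ j : Fin (s i).len, (s i).sign j = 1 ∧ w = markedPoint j := by
  rcases b with j | ⟨i', j⟩
  · have := H.norm_hole_lt i hw
    rw [← h] at this
    exact absurd this (norm_markedPoint j.1).not_lt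
  · obtain rfl := H.hole_eq_hole (norm_markedPoint j.1).le hw h
    exact ⟨j.1, j.2, (H.hole_injective _ h).symm⟩

theorem beginPoint_eq_markedPoint {b : BeginMark s s₀} {j : Fin s₀.len}
    (h : H.beginPoint s s₀ b = markedPoint j) : s₀.sign j = 1 := by
  rcases b with j' | ⟨i, j'⟩
  · rw [← markedPoint_injective h]
    exact j'.2
  · have := H.norm_hole_lt i (norm_markedPoint j'.1).le
    exact absurd ((congrArg norm h).trans (norm_markedPoint j)) this.ne

theorem endPoint_eq_markedPoint {b : EndMark s s₀} {j : Fin s₀.len}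
    (h : H.endPoint s s₀ b = markedPoint j) : s₀.sign j = -1 := by
  rcases b with j' | ⟨i, j'⟩
  · rw [← markedPoint_injective h]
    exact j'.2
  · have := H.norm_hole_lt i (norm_markedPoint j'.1).le
    exact absurd ((congrArg norm h).trans (norm_markedPoint j)) this.ne

end Marks

end HoledDisc

/-! ### The strands of a tangle and of a composite -/

namespace Strands

variable {A Λ A' Λ' : Type} (S : Strands A Λ)

/-- The images of the strands under a map of the plane. -/
noncomputable def map (f : C(ℂ, ℂ)) : Strands A Λ := ⟨fun a => f.comp (S.arc a), fun l => f.comp (S.loop l)⟩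

/-- The strands of two families. -/
def sum (S' : Strands A' Λ') : Strands (A ⊕ A') (Λ ⊕ Λ') :=
  ⟨Sum.elim S.arc S'.arc, Sum.elim S.loop S'.loop⟩

/-- The same strands, with the intervals indexed differently. -/
def comap (e : A' ≃ A) : Strands A' Λ := ⟨S.arc ∘ e, S.loop⟩

variable {S}

theorem Embedded.weaklyEmbedded (h : S.Embedded) : S.WeaklyEmbedded :=
  ⟨fun e => .inl (h.arc_eq e), h.arc_ne_loop, h.loop_eq⟩

theorem Embedded.map (h : S.Embedded) {f : C(ℂ, ℂ)} (hf : Function.Injective f) :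
    (S.map f).Embedded :=
  ⟨fun e => h.arc_eq (hf e), fun _ _ _ _ e => h.arc_ne_loop _ _ _ _ (hf e),
    fun e => h.loop_eq (hf e)⟩

theorem WeaklyEmbedded.comap (h : S.WeaklyEmbedded) (e : A' ≃ A) : (S.comap e).WeaklyEmbedded := by
  refine ⟨fun h' => ?_, fun _ => h.arc_ne_loop _, h.loop_eq⟩
  rcases h.arc_eq h' with h' | h'
  · exact .inl ⟨e.injective h'.1, h'.2⟩
  · exact .inr h'

theorem comap_support (e : A' ≃ A) : (S.comap e).support = S.support := by
  unfold support
  congr 1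
  exact e.surjective.iUnion_comp fun a => Set.range (S.arc a)

theorem comap_isPositivePath (e : A' ≃ A) {γ : I → ℂ} :
    (S.comap e).IsPositivePath γ ↔ S.IsPositivePath γ := by
  refine or_congr ⟨fun ⟨a, h⟩ => ⟨e a, h⟩, fun ⟨a, h⟩ => ⟨e.symm a, ?_⟩⟩ Iff.rfl
  simpa [Strands.comap] using h

theorem map_isPositivePath {f : C(ℂ, ℂ)} {γ : I → ℂ} :
    (S.map f).IsPositivePath γ ↔ ∃ γ', S.IsPositivePath γ' ∧ γ = f ∘ γ' := by
  constructor
  · rintro (⟨a, φ, h1, h2, h3⟩ | ⟨l, φ, h1, h2, h3⟩)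
    · exact ⟨_, .inl ⟨a, φ, h1, h2, fun _ => rfl⟩, funext h3⟩
    · exact ⟨_, .inr ⟨l, φ, h1, h2, fun _ => rfl⟩, funext h3⟩
  · rintro ⟨γ', ⟨a, φ, h1, h2, h3⟩ | ⟨l, φ, h1, h2, h3⟩, rfl⟩
    · exact .inl ⟨a, φ, h1, h2, fun t => congrArg f (h3 t)⟩
    · exact .inr ⟨l, φ, h1, h2, fun t => congrArg f (h3 t)⟩

theorem sum_isPositivePath {S' : Strands A' Λ'} {γ : I → ℂ} :
    (S.sum S').IsPositivePath γ ↔ S.IsPositivePath γ ∨ S'.IsPositivePath γ := by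
  simp only [IsPositivePath, Sum.exists, sum, Sum.elim_inl, Sum.elim_inr]
  exact or_or_or_comm

theorem map_support {f : C(ℂ, ℂ)} : (S.map f).support = f '' S.support := by
  simp only [support, map, Set.image_union, Set.image_iUnion, ContinuousMap.coe_comp,
    Set.range_comp]

theorem sum_support {S' : Strands A' Λ'} : (S.sum S').support = S.support ∪ S'.support := by
  ext z
  simp only [support, sum, Set.iUnion_sum, Sum.elim_inl, Sum.elim_inr, Set.mem_union]
  tauto

/-- Isotopy is stated through positive paths alone; since they determine the support, it yields an
equality of supports. -/
theorem mem_support_iff {z : ℂ} : z ∈ S.support ↔ ∃ γ t, S.IsPositivePath γ ∧ γ t = z := by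
  constructor
  · rintro (h | h)
    · obtain ⟨a, t, rfl⟩ := Set.mem_iUnion.mp h
      exact ⟨_, t, S.isPositivePath_arc a, rfl⟩
    · obtain ⟨l, u, rfl⟩ := Set.mem_iUnion.mp h
      obtain ⟨t, -, rfl⟩ := exists_unitInterval_coe u
      exact ⟨_, t, S.isPositivePath_loop l, rfl⟩
  · rintro ⟨γ, t, ⟨a, φ, -, -, h⟩ | ⟨l, φ, -, -, h⟩, rfl⟩
    · exact .inl (Set.mem_iUnion.mpr ⟨a, _, (h t).symm⟩)
    · exact .inr (Set.mem_iUnion.mpr ⟨l, _, (h t).symm⟩)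

end Strands

namespace PlanarTangle

variable {ι κ : Type} {s : ι → SignSeq} {s₀ : SignSeq} (T : PlanarTangle s s₀)

/-- The strands of a tangle. -/
def strands : Strands (BeginMark s s₀) (Fin T.circles) := ⟨T.arc, T.loop⟩

theorem strands_embedded : T.strands.Embedded := by
  refine ⟨fun {a t a' t'} e => ?_, fun a t l u e => ?_, fun {l u l' u'} e => ?_⟩
  · exact Prod.mk.inj (Sum.inl_injective (@T.injective (.inl (a, t)) (.inl (a', t')) e))
  · cases @T.injective (.inl (a, t)) (.inr (l, u)) e
  · exact Prod.mk.inj (Sum.inr_injective (@T.injective (.inr (l, u)) (.inr (l', u')) e))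

/-- The marked point at which strands begin lies on the strand that is indexed by it. -/
theorem beginPoint_mem_strand (b : BeginMark s s₀) :
    T.beginPoint s s₀ b ∈ T.strands.strand (.inl b) := ⟨0, T.arc_zero b⟩

theorem endPoint_mem_strand (e : EndMark s s₀) :
    T.endPoint s s₀ e ∈ T.strands.strand (.inl (T.matching.symm e)) :=
  ⟨1, by rw [← T.matching.apply_symm_apply e, ← T.arc_one, T.matching.apply_symm_apply]; rfl⟩

/-- By disjointness a marked point lies on only one strand. So the matching can be read off from the
strands as sets, without their parametrization. -/
theorem matching_eq_of_mem_strand {c : BeginMark s s₀ ⊕ Fin T.circles} {b : BeginMark s s₀}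
    {e : EndMark s s₀} (hb : T.beginPoint s s₀ b ∈ T.strands.strand c)
    (he : T.endPoint s s₀ e ∈ T.strands.strand c) : T.matching b = e := by
  have h1 := T.strands_embedded.strand_unique (T.beginPoint_mem_strand b) hb
  have h2 := T.strands_embedded.strand_unique (T.endPoint_mem_strand e) he
  rw [Sum.inl_injective (h1.trans h2.symm), Equiv.apply_symm_apply]

theorem norm_arc_le (b : BeginMark s s₀) (t : I) : ‖T.arc b t‖ ≤ 1 := by
  by_cases h0 : t = 0
  · rw [h0, T.arc_zero]
    exact T.norm_beginPoint_le b
  by_cases h1 : t = 1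
  · rw [h1, T.arc_one]
    exact T.norm_endPoint_le _
  exact (T.arc_mem b t h0 h1).1.le

/-- A strand meets a hole only in marked points on its boundary. -/
theorem arc_eq_hole {b : BeginMark s s₀} {t : I} {i : ι} {w : ℂ} (hw : ‖w‖ ≤ 1)
    (h : T.arc b t = T.hole i w) : ∃ j : Fin (s i).len, w = markedPoint j ∧
      ((t = 0 ∧ (s i).sign j = -1) ∨ (t = 1 ∧ (s i).sign j = 1)) := by
  by_cases h0 : t = 0
  · rw [h0, T.arc_zero] at h
    obtain ⟨j, hj, e⟩ := T.beginPoint_eq_hole hw h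
    exact ⟨j, e, .inl ⟨h0, hj⟩⟩
  by_cases h1 : t = 1
  · rw [h1, T.arc_one] at h
    obtain ⟨j, hj, e⟩ := T.endPoint_eq_hole hw h
    exact ⟨j, e, .inr ⟨h1, hj⟩⟩
  have := T.arc_mem b t h0 h1
  rw [h] at this
  exact absurd this (T.hole_notMem_interior i hw)

theorem arc_eq_markedPoint {b : BeginMark s s₀} {t : I} {j : Fin s₀.len}
    (h : T.arc b t = markedPoint j) :
    (t = 0 ∧ s₀.sign j = 1) ∨ (t = 1 ∧ s₀.sign j = -1) := by
  by_cases h0 : t = 0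
  · rw [h0, T.arc_zero] at h
    exact .inl ⟨h0, T.beginPoint_eq_markedPoint h⟩
  by_cases h1 : t = 1
  · rw [h1, T.arc_one] at h
    exact .inr ⟨h1, T.endPoint_eq_markedPoint h⟩
  have := (T.arc_mem b t h0 h1).1
  rw [h, norm_markedPoint] at this
  exact absurd this (lt_irrefl _)

/-! ### The pieces of a composite and their junctions -/

variable (i : ι) {s' : κ → SignSeq} (T' : PlanarTangle s' (s i))

/-- The map that places the disc into the `i`-th hole, as a continuous map. -/
noncomputable def holeMap : C(ℂ, ℂ) := ⟨T.hole i, T.continuous_hole i⟩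

/-- The strands of `T` and of `T'`, placed into the `i`-th hole of `T`. -/
noncomputable def pieces : Strands (BeginMark s s₀ ⊕ BeginMark s' (s i)) (Fin T.circles ⊕ Fin T'.circles) :=
  T.strands.sum (T'.strands.map (T.holeMap i))

/-- The strands of `T` stay outside the open hole and the image of `T'` stays inside its closure, so
they meet only at marked points of the common circle. Signs have opposite meanings on an inner and
on an outer circle, so there one strand ends and the other begins. -/
theorem pieces_weaklyEmbedded : (T.pieces i T').WeaklyEmbedded := by
  have h := T.strands_embedded
  have h' := T'.strands_embedded.map (f := T.holeMap i) (T.hole_injective i)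
  have cross : ∀ b t b' t', T.arc b t = T.hole i (T'.arc b' t') →
      (t = 1 ∧ t' = 0) ∨ t = 0 ∧ t' = 1 := by
    intro b t b' t' e
    obtain ⟨j, hj, hs⟩ := T.arc_eq_hole (T'.norm_arc_le b' t') e
    rcases T'.arc_eq_markedPoint hj with ⟨h1, h2⟩ | ⟨h1, h2⟩ <;> rcases hs with ⟨h3, h4⟩ | ⟨h3, h4⟩
    · exact absurd rfl (HoledDisc.sign_ne h2 h4)
    · exact .inl ⟨h3, h1⟩
    · exact .inr ⟨h3, h1⟩
    · exact absurd rfl (HoledDisc.sign_ne h4 h2)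
  refine ⟨?_, ?_, ?_⟩
  · rintro (b | b) t (b' | b') t' e
    · exact .inl ⟨congrArg _ (h.arc_eq e).1, (h.arc_eq e).2⟩
    · exact .inr (cross _ _ _ _ e)
    · exact .inr ((cross _ _ _ _ e.symm).symm.imp And.symm And.symm)
    · exact .inl ⟨congrArg _ (h'.arc_eq e).1, (h'.arc_eq e).2⟩
  · rintro (b | b) t (l | l) u e
    · exact h.arc_ne_loop _ _ _ _ e
    · have hl := T'.loop_mem l u
      obtain ⟨j, hj, -⟩ := T.arc_eq_hole hl.1.le e
      rw [hj] at hl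
      exact absurd hl.1 (norm_markedPoint j).not_lt
    · have hl := T.loop_mem l u
      have e' : T.hole i (T'.arc b t) = T.loop l u := e
      rw [← e'] at hl
      exact T.hole_notMem_interior i (T'.norm_arc_le b t) hl
    · exact h'.arc_ne_loop _ _ _ _ e
  · have cross' : ∀ l u l' u', T.loop l u ≠ T.hole i (T'.loop l' u') := by
      intro l u l' u' e
      have hl := T.loop_mem l u
      rw [e] at hl
      exact T.hole_notMem_interior i (T'.loop_mem l' u').1.le hl
    rintro (l | l) u (l' | l') u' e
    · exact ⟨congrArg _ (h.loop_eq e).1, (h.loop_eq e).2⟩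
    · exact absurd e (cross' _ _ _ _)
    · exact absurd e.symm (cross' _ _ _ _)
    · exact ⟨congrArg _ (h'.loop_eq e).1, (h'.loop_eq e).2⟩

/-- The marked points along which tangles are glued: those at which strands of the outer tangle
begin, and those at which they end. -/
abbrev GluedMark (a : SignSeq) : Type :=
  {j : Fin a.len // a.sign j = -1} ⊕ {j : Fin a.len // a.sign j = 1}

/-- The underlying numbered point of a glued marked point. -/
def GluedMark.index {a : SignSeq} (g : GluedMark a) : Fin a.len := g.elim Subtype.val Subtype.val

theorem GluedMark.index_injective {a : SignSeq} :
    Function.Injective (GluedMark.index : GluedMark a → Fin a.len) := by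
  rintro (j | j) (j' | j') h
  · exact congrArg _ (Subtype.ext h)
  · exact absurd h.symm (HoledDisc.sign_ne j'.2 j.2)
  · exact absurd h (HoledDisc.sign_ne j.2 j'.2)
  · exact congrArg _ (Subtype.ext h)

/-- The position of a glued marked point. -/
noncomputable def gluedPoint (g : GluedMark (s i)) : ℂ := T.hole i (markedPoint g.index)

theorem gluedPoint_injective : Function.Injective (T.gluedPoint i) := fun _ _ h =>
  GluedMark.index_injective (markedPoint_injective (T.hole_injective i h))

variable (s s₀ s') in
/-- The beginning points of the strands of two tangles that are to be glued. -/
noncomputable def splitBegin :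
    BeginMark (Sum.elim (fun j : {j // j ≠ i} => s j.1) s') s₀ ⊕ GluedMark (s i) ≃
      BeginMark s s₀ ⊕ BeginMark s' (s i) :=
  splitEquiv (fun a : SignSeq => {j : Fin a.len // a.sign j = -1})
    {j : Fin s₀.len // s₀.sign j = 1} {j : Fin (s i).len // (s i).sign j = 1} s i s'

variable (s s₀ s') in
/-- The ending points of the strands of two tangles that are to be glued. -/
noncomputable def splitEnd :
    EndMark (Sum.elim (fun j : {j // j ≠ i} => s j.1) s') s₀ ⊕ GluedMark (s i) ≃
      EndMark s s₀ ⊕ EndMark s' (s i) :=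
  -- For ending points the hole of `T` contributes the positive marks and the outer circle of `T'`
  -- the negative ones. The swap restores the order of `GluedMark`, so that the same element names a
  -- point as an end and as a beginning.
  ((Equiv.refl _).sumCongr (Equiv.sumComm _ _)).trans
    (splitEquiv (fun a : SignSeq => {j : Fin a.len // a.sign j = 1})
      {j : Fin s₀.len // s₀.sign j = -1} {j : Fin (s i).len // (s i).sign j = -1} s i s')

/-- The intervals of `T` and `T'` as seen by the gluing. -/
noncomputable def markGluing :
    BeginMark (Sum.elim (fun j : {j // j ≠ i} => s j.1) s') s₀ ⊕ GluedMark (s i) ≃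
      EndMark (Sum.elim (fun j : {j // j ≠ i} => s j.1) s') s₀ ⊕ GluedMark (s i) :=
  (splitBegin s s₀ i s').trans ((T.matching.sumCongr T'.matching).trans (splitEnd s s₀ i s').symm)

/-- The disc with holes of a composite tangle. -/
abbrev compDisc : HoledDisc ({j // j ≠ i} ⊕ κ) := T.toHoledDisc.comp i T'.toHoledDisc

theorem pieces_start (z) : (T.pieces i T').arc (splitBegin s s₀ i s' z) 0 =
    Sum.elim ((T.compDisc i T').beginPoint _ s₀) (T.gluedPoint i) z := by
  rcases z with (j | ⟨l | m, j⟩) | (j | j)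
  · exact T.arc_zero (.inl j)
  · exact T.arc_zero (.inr ⟨l.1, j⟩)
  · exact (congrArg (T.hole i) (T'.arc_zero (.inr ⟨m, j⟩))).trans
      (T.comp_hole_inr i T'.toHoledDisc m _).symm
  · exact T.arc_zero (.inr ⟨i, j⟩)
  · exact congrArg (T.hole i) (T'.arc_zero (.inl j))

theorem splitEnd_position (z) :
    Sum.elim (T.endPoint s s₀) (fun e => T.hole i (T'.endPoint s' (s i) e)) (splitEnd s s₀ i s' z) =
      Sum.elim ((T.compDisc i T').endPoint _ s₀) (T.gluedPoint i) z := by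
  rcases z with (j | ⟨l | m, j⟩) | (j | j)
  · rfl
  · rfl
  · exact (T.comp_hole_inr i T'.toHoledDisc m _).symm
  · rfl
  · rfl

theorem pieces_end (z) : (T.pieces i T').arc (splitBegin s s₀ i s' z) 1 =
    Sum.elim ((T.compDisc i T').endPoint _ s₀) (T.gluedPoint i) (T.markGluing i T' z) := by
  rw [← splitEnd_position, markGluing, Equiv.trans_apply, Equiv.trans_apply,
    Equiv.apply_symm_apply]
  rcases splitBegin s s₀ i s' z with b | b
  · exact T.arc_one b
  · exact congrArg (T.hole i) (T'.arc_one b)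

theorem gluedPoint_mem_interior (g : GluedMark (s i)) :
    T.gluedPoint i g ∈ (T.compDisc i T').interior :=
  T.hole_circle_subset_comp i T'.toHoledDisc (norm_markedPoint _)

/-- The passage from geometry to combinatorics: glued points are interior to the composite disc
while its marks are not, and beginning marks differ from ending marks, so an end can coincide with a
beginning only at one and the same glued point. -/
theorem pieces_next (z z') :
    (T.pieces i T').arc (splitBegin s s₀ i s' z) 1 = (T.pieces i T').arc (splitBegin s s₀ i s' z') 0 ↔
      GlueStep (T.markGluing i T') z z' := by
  rw [pieces_start, pieces_end]
  constructor
  · intro h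
    rcases hq : T.markGluing i T' z with e | g <;> rw [hq] at h <;> rcases z' with b | g' <;>
      simp only [Sum.elim_inl, Sum.elim_inr] at h
    · exact absurd h.symm (HoledDisc.beginPoint_ne_endPoint _ _ _)
    · have := T.gluedPoint_mem_interior i T' g'
      rw [← h] at this
      exact absurd this (HoledDisc.endPoint_notMem_interior _ _)
    · have := T.gluedPoint_mem_interior i T' g
      rw [h] at this
      exact absurd this (HoledDisc.beginPoint_notMem_interior _ _)
    · exact ⟨g, hq, by rw [T.gluedPoint_injective i h]⟩
  · rintro ⟨g, hg, rfl⟩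
    rw [hg]
    rfl

theorem pieces_support :
    (T.pieces i T').support = T.support ∪ T.hole i '' T'.support :=
  Strands.sum_support.trans (congrArg _ Strands.map_support)

theorem pieces_isPositivePath {γ : I → ℂ} : (T.pieces i T').IsPositivePath γ ↔
    T.IsPositivePath γ ∨ ∃ γ', T'.IsPositivePath γ' ∧ γ = T.hole i ∘ γ' :=
  Strands.sum_isPositivePath.trans (or_congr Iff.rfl Strands.map_isPositivePath)

end PlanarTangle

namespace PlanarTangle

variable {ι κ : Type} {s : ι → SignSeq} {s₀ : SignSeq}

/-! ### Composites of tangles exist -/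

section Existence

variable (T : PlanarTangle s s₀) (i : ι) {s' : κ → SignSeq} (T' : PlanarTangle s' (s i))

/-- The inputs of a composite. -/
abbrev compInputs (s : ι → SignSeq) (i : ι) (s' : κ → SignSeq) : {j // j ≠ i} ⊕ κ → SignSeq :=
  Sum.elim (fun j => s j.1) s'

theorem pieces_starts : (T.pieces i T').starts =
    Set.range ((T.compDisc i T').beginPoint (compInputs s i s') s₀) ∪ Set.range (T.gluedPoint i) := by
  rw [← Set.Sum.elim_range, Strands.starts, ← (splitBegin s s₀ i s').surjective.range_comp]
  exact congrArg Set.range (funext fun z => T.pieces_start i T' z)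

theorem pieces_ends : (T.pieces i T').ends =
    Set.range ((T.compDisc i T').endPoint (compInputs s i s') s₀) ∪ Set.range (T.gluedPoint i) := by
  rw [← Set.Sum.elim_range, Strands.ends, ← (splitBegin s s₀ i s').surjective.range_comp,
    ← (T.markGluing i T').surjective.range_comp (Sum.elim _ _)]
  exact congrArg Set.range (funext fun z => T.pieces_end i T' z)

theorem pieces_starts_diff : (T.pieces i T').starts \ (T.pieces i T').ends =
    Set.range ((T.compDisc i T').beginPoint (compInputs s i s') s₀) := by
  rw [pieces_starts, pieces_ends]
  ext z
  constructor
  · rintro ⟨h | h, h'⟩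
    · exact h
    · exact absurd (.inr h) h'
  · rintro ⟨b, rfl⟩
    refine ⟨.inl ⟨b, rfl⟩, ?_⟩
    rintro (⟨e, he⟩ | ⟨g, hg⟩)
    · exact HoledDisc.beginPoint_ne_endPoint _ _ _ he.symm
    · have := T.gluedPoint_mem_interior i T' g
      rw [hg] at this
      exact HoledDisc.beginPoint_notMem_interior _ _ this

theorem pieces_ends_diff : (T.pieces i T').ends \ (T.pieces i T').starts =
    Set.range ((T.compDisc i T').endPoint (compInputs s i s') s₀) := by
  rw [pieces_starts, pieces_ends]
  ext z
  constructor
  · rintro ⟨h | h, h'⟩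
    · exact h
    · exact absurd (.inr h) h'
  · rintro ⟨b, rfl⟩
    refine ⟨.inl ⟨b, rfl⟩, ?_⟩
    rintro (⟨e, he⟩ | ⟨g, hg⟩)
    · exact HoledDisc.beginPoint_ne_endPoint _ _ _ he
    · have := T.gluedPoint_mem_interior i T' g
      rw [hg] at this
      exact HoledDisc.endPoint_notMem_interior _ _ this

/-- This depends on the support alone, so it survives the gluing and puts the strands of the
composite into the right region. -/
theorem pieces_support_cases {z : ℂ} (hz : z ∈ (T.pieces i T').support) :
    z ∈ (T.compDisc i T').interior ∨ z ∈ Set.range ((T.compDisc i T').beginPoint (compInputs s i s') s₀) ∨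
      z ∈ Set.range ((T.compDisc i T').endPoint (compInputs s i s') s₀) := by
  rcases hz with hz | hz
  · obtain ⟨p, t, rfl⟩ := Set.mem_iUnion.mp hz
    by_cases h0 : t = 0
    · obtain ⟨z, rfl⟩ := (splitBegin s s₀ i s').surjective p
      rw [h0, pieces_start]
      rcases z with b | g
      · exact .inr (.inl ⟨b, rfl⟩)
      · exact .inl (T.gluedPoint_mem_interior i T' g)
    by_cases h1 : t = 1
    · obtain ⟨z, rfl⟩ := (splitBegin s s₀ i s').surjective p
      rw [h1, pieces_end]
      rcases T.markGluing i T' z with b | g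
      · exact .inr (.inr ⟨b, rfl⟩)
      · exact .inl (T.gluedPoint_mem_interior i T' g)
    rcases p with b | b
    · exact .inl (T.interior_subset_comp i T'.toHoledDisc (T.arc_mem b t h0 h1))
    · exact .inl (T.hole_interior_subset_comp i T'.toHoledDisc (T'.arc_mem b t h0 h1))
  · obtain ⟨l | l, u, rfl⟩ := Set.mem_iUnion.mp hz
    · exact .inl (T.interior_subset_comp i T'.toHoledDisc (T.loop_mem l u))
    · exact .inl (T.hole_interior_subset_comp i T'.toHoledDisc (T'.loop_mem l u))

theorem exists_equiv_of_range_eq {A B : Type} {u : B → ℂ} {v : A → ℂ} (hu : Function.Injective u)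
    (hv : Function.Injective v) (h : Set.range v = Set.range u) : ∃ e : B ≃ A, ∀ b, v (e b) = u b := by
  refine ⟨(Equiv.ofInjective u hu).trans ((Equiv.setCongr h.symm).trans
    (Equiv.ofInjective v hv).symm), fun b => ?_⟩
  simp only [Equiv.trans_apply]
  exact Equiv.apply_ofInjective_symm hv _

/-- Composable tangles have a composite. -/
theorem exists_isComp [Finite ι] [Finite κ] : ∃ T'', T.IsComp i T' T'' := by
  obtain ⟨A, n, S, hS, hG⟩ := (T.pieces_weaklyEmbedded i T').exists_embedded
  have hdisj : ∀ a b, S.arc a 0 ≠ S.arc b 1 := fun a b e => zero_ne_one (hS.arc_eq e).2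
  -- In an embedded family no beginning is an end, so the difference preserved by gluing is the full
  -- set of beginnings.
  have hstarts : S.starts = Set.range ((T.compDisc i T').beginPoint (compInputs s i s') s₀) := by
    rw [← pieces_starts_diff, ← hG.starts_eq, eq_comm, sdiff_eq_left, Set.disjoint_left]
    rintro _ ⟨a, rfl⟩ ⟨b, e⟩
    exact hdisj a b e.symm
  have hends : S.ends = Set.range ((T.compDisc i T').endPoint (compInputs s i s') s₀) := by
    rw [← pieces_ends_diff, ← hG.ends_eq, eq_comm, sdiff_eq_left, Set.disjoint_left]
    rintro _ ⟨a, rfl⟩ ⟨b, e⟩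
    exact hdisj b a e
  obtain ⟨f, hf⟩ := exists_equiv_of_range_eq (T.compDisc i T').beginPoint_injective
    (fun _ _ e => hS.weaklyEmbedded.start_injective e) hstarts
  obtain ⟨g, hg⟩ := exists_equiv_of_range_eq (T.compDisc i T').endPoint_injective
    (fun _ _ e => hS.weaklyEmbedded.end_injective e) hends
  have hsupp : ∀ z ∈ S.support, z ∈ (T.compDisc i T').interior ∨
      (∃ a, z = S.arc a 0) ∨ ∃ a, z = S.arc a 1 := by
    intro z hz
    rw [hG.support_eq] at hz
    refine (T.pieces_support_cases i T' hz).imp_right (Or.imp ?_ ?_)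
    · rintro ⟨b, rfl⟩
      exact ⟨f b, (hf b).symm⟩
    · rintro ⟨b, rfl⟩
      exact ⟨g b, (hg b).symm⟩
  let T'' : PlanarTangle (Sum.elim (fun j : {j // j ≠ i} => s j.1) s') s₀ :=
    { toHoledDisc := T.compDisc i T'
      matching := f.trans g.symm
      arc := fun b => S.arc (f b)
      circles := n
      loop := S.loop
      arc_zero := hf
      arc_one := fun b => by rw [← hg, Equiv.trans_apply, Equiv.apply_symm_apply]
      -- A point of the support outside the interior is an end of some arc, which embeddedness
      -- excludes for `t ≠ 0, 1`; likewise for circles.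
      arc_mem := fun b t h0 h1 => by
        rcases hsupp _ (.inl (Set.mem_iUnion.mpr ⟨f b, t, rfl⟩)) with h | ⟨a, h⟩ | ⟨a, h⟩
        · exact h
        · exact absurd (hS.arc_eq h).2 h0
        · exact absurd (hS.arc_eq h).2 h1
      loop_mem := fun l u => by
        rcases hsupp _ (.inr (Set.mem_iUnion.mpr ⟨l, u, rfl⟩)) with h | ⟨a, h⟩ | ⟨a, h⟩
        · exact h
        · exact absurd h.symm (hS.arc_ne_loop _ _ _ _)
        · exact absurd h.symm (hS.arc_ne_loop _ _ _ _)
      injective := by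
        rintro (⟨b, t⟩ | ⟨l, u⟩) (⟨b', t'⟩ | ⟨l', u'⟩) e
        · exact congrArg Sum.inl (Prod.ext (f.injective (hS.arc_eq e).1) (hS.arc_eq e).2)
        · exact absurd e (hS.arc_ne_loop _ _ _ _)
        · exact absurd e.symm (hS.arc_ne_loop _ _ _ _)
        · exact congrArg Sum.inr (Prod.ext (hS.loop_eq e).1 (hS.loop_eq e).2) }
  have hstr : T''.strands = S.comap f := rfl
  have hpath : ∀ γ, (T.pieces i T').IsPositivePath γ → T''.IsPositivePath γ := fun γ h =>
    (Strands.comap_isPositivePath f).mpr (hG.path h)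
  refine ⟨T'', T.comp_hole_inl i T'.toHoledDisc, T.comp_hole_inr i T'.toHoledDisc, ?_,
    fun γ h => hpath _ ((T.pieces_isPositivePath i T').mpr (.inl h)),
    fun γ h => hpath _ ((T.pieces_isPositivePath i T').mpr (.inr ⟨γ, h, rfl⟩))⟩
  rw [← pieces_support, ← hG.support_eq]
  exact Strands.comap_support f

end Existence

/-! ### The matching and the number of circles of a composite -/

section Comp

variable {T : PlanarTangle s s₀} {i : ι} {s' : κ → SignSeq} {T' : PlanarTangle s' (s i)}
  {T'' : PlanarTangle (Sum.elim (fun j : {j // j ≠ i} => s j.1) s') s₀}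

theorem IsComp.disc_eq (h : T.IsComp i T' T'') : T''.toHoledDisc = T.compDisc i T' := by
  refine HoledDisc.ext_of_hole ?_
  rintro (j | m) z
  · exact h.1 j z
  · exact (h.2.1 m z).trans (T.comp_hole_inr i T'.toHoledDisc m z).symm

theorem IsComp.path (h : T.IsComp i T' T'') {γ : I → ℂ} (hγ : (T.pieces i T').IsPositivePath γ) :
    T''.strands.IsPositivePath γ := by
  rcases (T.pieces_isPositivePath i T').mp hγ with hγ | ⟨γ', hγ', rfl⟩
  · exact h.2.2.2.1 γ hγ
  · exact h.2.2.2.2 γ' hγ'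

/-- Each piece lies on one strand of `T''` and consecutive pieces share a point, so the whole chain
from `b` to `e` lies on a single strand. -/
theorem IsComp.matching_eq (h : T.IsComp i T' T'') {b e}
    (hbe : GlueLeads (T.markGluing i T') b e) : T''.matching b = e := by
  obtain ⟨z, hz, he⟩ := hbe
  have key : ∀ z, ∃ c, ∀ t, (T.pieces i T').arc (splitBegin s s₀ i s' z) t ∈ T''.strands.strand c :=
    fun z => (h.path (Strands.isPositivePath_arc _ _)).exists_strand
  choose c hc using key
  have hcz : c (.inl b) = c z := by
    clear he
    induction hz with
    | refl => rfl
    | @tail z z' _ hstep ih =>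
      have h1 := hc z 1
      rw [(T.pieces_next i T' z z').mpr hstep] at h1
      rw [ih]
      exact T''.strands_embedded.strand_unique h1 (hc z' 0)
  refine T''.matching_eq_of_mem_strand (c := c z) ?_ ?_
  · have := hc (.inl b) 0
    rwa [pieces_start, hcz, Sum.elim_inl, ← h.disc_eq] at this
  · have := hc z 1
    rwa [pieces_end, he, Sum.elim_inl, ← h.disc_eq] at this

theorem IsComp.circles_eq [Finite ι] [Finite κ] (h : T.IsComp i T' T'') :
    T''.circles = T.circles + T'.circles + glueCircles (T.markGluing i T') := by
  have := Strands.card_loops_of_glued (S := (T.pieces i T').comap (splitBegin s s₀ i s'))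
    (q := T.markGluing i T') ((T.pieces_weaklyEmbedded i T').comap _) T''.strands_embedded
    (T.pieces_next i T') (fun γ hγ => h.path ((Strands.comap_isPositivePath _).mp hγ))
    (by rw [Strands.comap_support, pieces_support]; exact h.2.2.1) (fun z e he => by
      refine ⟨T''.matching.symm e, ?_⟩
      refine Eq.trans (T''.arc_one _) ?_
      rw [Equiv.apply_symm_apply]
      refine Eq.trans ?_ (T.pieces_end i T' z).symm
      rw [he, Sum.elim_inl, ← h.disc_eq])
  simpa using this

end Comp

/-! ### Isotopy invariance -/

/-- Only the final homeomorphism matters. It carries marks to marks and positive paths to positive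
paths in both directions, so the image of `T` and the tangle `T'` have the same support, and the
comparison of strands applies with `Empty` as the set of glued points. -/
theorem Isotopic.matching_circles [Finite ι] {T T' : PlanarTangle s s₀} (h : T.Isotopic T') :
    T.matching = T'.matching ∧ T.circles = T'.circles := by
  obtain ⟨h, -, -, hout, hhole, hpath⟩ := h
  have hb : ∀ b, h 1 (T.beginPoint s s₀ b) = T'.beginPoint s s₀ b := by
    rintro (j | ⟨i, j⟩)
    · exact hout 1 _ (norm_markedPoint j.1).ge
    · exact hhole i _ (norm_markedPoint j.1).le
  have he : ∀ b, h 1 (T.endPoint s s₀ b) = T'.endPoint s s₀ b := by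
    rintro (j | ⟨i, j⟩)
    · exact hout 1 _ (norm_markedPoint j.1).ge
    · exact hhole i _ (norm_markedPoint j.1).le
  let S := T.strands.map (h 1 : C(ℂ, ℂ))
  have hS : S.Embedded := T.strands_embedded.map (h 1).injective
  have hSpath : ∀ γ, S.IsPositivePath γ → T'.strands.IsPositivePath γ := by
    intro γ hγ
    obtain ⟨γ', hγ', rfl⟩ := Strands.map_isPositivePath.mp hγ
    exact (hpath γ').mp hγ'
  have hsupp : T'.strands.support = S.support := by
    ext z
    rw [Strands.mem_support_iff, Strands.mem_support_iff]
    constructor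
    · rintro ⟨γ, t, hγ, rfl⟩
      refine ⟨γ, t, Strands.map_isPositivePath.mpr ⟨(h 1).symm ∘ γ, (hpath _).mpr ?_, ?_⟩, rfl⟩
      · simp only [Function.comp_apply, Homeomorph.apply_symm_apply]
        exact hγ
      · funext t; simp
    · rintro ⟨γ, t, hγ, rfl⟩
      exact ⟨γ, t, hSpath γ hγ, rfl⟩
  have hend : ∀ b, S.arc b 1 = T'.endPoint s s₀ (T.matching b) := fun b =>
    (congrArg (h 1) (T.arc_one b)).trans (he _)
  constructor
  · ext1 b
    obtain ⟨c, hc⟩ := (hSpath _ (S.isPositivePath_arc b)).exists_strand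
    refine (T'.matching_eq_of_mem_strand (c := c) ?_ ?_).symm
    · rw [← hb, ← T.arc_zero]
      exact hc 0
    · rw [← hend]
      exact hc 1
  · have hq : IsEmpty {K : Quot (fun g g' : Empty =>
        (T.matching.sumCongr (Equiv.refl Empty)) (Sum.inr g) = Sum.inr g') //
        ∀ g, Quot.mk _ g = K → ∀ y, (T.matching.sumCongr (Equiv.refl Empty)) (Sum.inr g) ≠
          Sum.inl y} := ⟨fun K => (Quot.mk_surjective K.1).choose.elim⟩
    have := Strands.card_loops_of_glued (S := S.comap (Equiv.sumEmpty _ Empty))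
      (q := T.matching.sumCongr (Equiv.refl Empty)) (hS.weaklyEmbedded.comap _) T'.strands_embedded
      (fun z z' => ⟨fun e => absurd (hS.arc_eq e).2 one_ne_zero, fun ⟨g, _⟩ => g.elim⟩)
      (fun γ hγ => hSpath γ ((Strands.comap_isPositivePath _).mp hγ))
      (hsupp.trans (Strands.comap_support _).symm) (fun z e hz => by
        rcases z with b | g
        · refine ⟨T'.matching.symm e, Eq.trans (T'.arc_one _) ?_⟩
          rw [Equiv.apply_symm_apply]
          refine Eq.trans ?_ (hend b).symm
          rw [← Sum.inl_injective hz]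
        · exact g.elim)
    rw [glueCircles, @Nat.card_of_isEmpty _ hq] at this
    simpa using this.symm

end PlanarTangle

/-! ### Relabelling a gluing -/

section Relabel

variable {X Y G X' Y' G' : Type} {q : X ⊕ G ≃ Y ⊕ G} {q' : X' ⊕ G' ≃ Y' ⊕ G'}
  {eX : X ≃ X'} {eY : Y ≃ Y'} {eG : G ≃ G'}

theorem GlueLeads.relabel (hq : ∀ z, q' (eX.sumCongr eG z) = eY.sumCongr eG (q z)) {x : X} {y : Y}
    (h : GlueLeads q x y) : GlueLeads q' (eX x) (eY y) := by
  obtain ⟨z, hz, hy⟩ := h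
  refine ⟨eX.sumCongr eG z, ?_, by rw [hq, hy]; rfl⟩
  refine Relation.ReflTransGen.lift (eX.sumCongr eG) ?_ _ _ hz
  rintro z _ ⟨g, hg, rfl⟩
  exact ⟨eG g, by rw [hq, hg]; rfl, rfl⟩

theorem glueCircles_relabel (hq : ∀ z, q' (eX.sumCongr eG z) = eY.sumCongr eG (q z)) :
    glueCircles q' = glueCircles q := by
  have hq' : ∀ g, q' (.inr (eG g)) = eY.sumCongr eG (q (.inr g)) := fun g => hq (.inr g)
  have hrel : ∀ g g', q (.inr g) = .inr g' ↔ q' (.inr (eG g)) = .inr (eG g') := by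
    intro g g'
    rw [hq']
    rcases q (.inr g) with y | g₁ <;> simp
  refine (Nat.card_congr (Equiv.subtypeEquiv (Quot.congr eG hrel) ?_)).symm
  · intro K
    obtain ⟨g, rfl⟩ := Quot.mk_surjective K
    have key : ∀ g, (∀ y', q' (.inr (eG g)) ≠ .inl y') ↔ ∀ y, q (.inr g) ≠ .inl y := by
      intro g
      rw [hq']
      rcases q (.inr g) with y | g₁
      · simp
      · simp
    refine ⟨fun h g' hg' => ?_, fun h g' hg' => ?_⟩
    · obtain ⟨g₁, rfl⟩ := eG.surjective g'
      exact (key g₁).mpr (h g₁ ((Quot.congr eG hrel).injective hg'))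
    · exact (key g').mp (h (eG g') (congrArg (Quot.congr eG hrel) hg'))

end Relabel

variable {L ι κ : Type}

/-! ### Transport of wiring diagrams along an equality of label sets -/

section Cast

variable {c₁ c₂ : ι → LabelPair L} {c₀ : LabelPair L}

/-- The bijection of labels of beginning points that is induced by an equality of label sets. -/
def castBegin (h : c₁ = c₂) : BeginLabel c₁ c₀ ≃ BeginLabel c₂ c₀ :=
  (Equiv.refl _).sumCongr (Equiv.sigmaCongrRight fun j => Equiv.cast (by rw [h]))

/-- The bijection of labels of ending points that is induced by an equality of label sets. -/
def castEnd (h : c₁ = c₂) : EndLabel c₁ c₀ ≃ EndLabel c₂ c₀ :=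
  (Equiv.refl _).sumCongr (Equiv.sigmaCongrRight fun j => Equiv.cast (by rw [h]))

theorem WiringDiagram.cast_matching (h : c₁ = c₂) (D : WiringDiagram c₁ c₀)
    (x : BeginLabel c₁ c₀) : (D.cast h).matching (castBegin h x) = castEnd h (D.matching x) := by
  subst h
  have h1 : castBegin (c₀ := c₀) (rfl : c₁ = c₁) x = x := by rcases x with x | ⟨j, x⟩ <;> rfl
  have h2 : ∀ y, castEnd (c₀ := c₀) (rfl : c₁ = c₁) y = y := by rintro (y | ⟨j, y⟩) <;> rfl
  rw [h1, h2]
  rfl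

theorem WiringDiagram.cast_circles (h : c₁ = c₂) (D : WiringDiagram c₁ c₀) :
    (D.cast h).circles = D.circles := by
  subst h
  rfl

/-- The label sets of a composite agree with the composite family of label sets only after a case
distinction on the input; this moves an action along that equality. -/
theorem act_reindex_cast {k : Type u} [Field k] (A : CircuitAction.{w} k L) {t : ℕ} (h : c₁ = c₂)
    (D : WiringDiagram c₁ c₀) (e : ι ≃ Fin t) (x : ∀ z, A.V (c₁ z)) (x' : ∀ z, A.V (c₂ z))
    (hx : ∀ z, x' z = cast (congrArg (fun c => (A.V (c z) : Type w)) h) (x z)) :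
    A.act (D.reindex e) (fun j => x (e.symm j)) =
      A.act ((D.cast h).reindex e) (fun j => x' (e.symm j)) := by
  subst h
  obtain rfl : x' = x := funext hx
  rfl

end Cast

/-! ### Compatibility of the underlying wiring diagram with the operations -/

namespace PlanarTangle

variable {s : ι → SignSeq} {s₀ : SignSeq} (ν : ℕ ↪ L)

theorem forget_matching (T : PlanarTangle s s₀) (b : BeginMark s s₀) :
    (T.forget ν).matching (beginLabelEquiv ν s s₀ b) = endLabelEquiv ν s s₀ (T.matching b) := by
  simp [forget]

theorem Isotopic.forget_eq [Finite ι] {T T' : PlanarTangle s s₀} (h : T.Isotopic T') :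
    T.forget ν = T'.forget ν :=
  WiringDiagram.ext (by simp only [forget, h.matching_circles.1]) h.matching_circles.2

theorem forget_id (a : SignSeq) : (PlanarTangle.id a).forget ν = WiringDiagram.id (a.labels ν) := by
  refine WiringDiagram.ext (Equiv.ext fun x => ?_) rfl
  obtain ⟨b, rfl⟩ := (beginLabelEquiv ν _ _).surjective x
  rw [forget_matching]
  rcases b with b | ⟨i, b⟩ <;> rfl

theorem forget_reindex (T : PlanarTangle s s₀) (e : ι ≃ κ) :
    (T.reindex e).forget ν = (T.forget ν).reindex e := by
  refine WiringDiagram.ext (Equiv.ext fun x => ?_) rfl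
  obtain ⟨b, rfl⟩ := (beginLabelEquiv ν _ _).surjective x
  rw [forget_matching]
  let EB := (Equiv.refl {j : Fin s₀.len // s₀.sign j = 1}).sumCongr
      (e.symm.sigmaCongrLeft (β := fun i => {j : Fin (s i).len // (s i).sign j = -1}))
  let EE := (Equiv.refl {j : Fin s₀.len // s₀.sign j = -1}).sumCongr
      (e.symm.sigmaCongrLeft (β := fun i => {j : Fin (s i).len // (s i).sign j = 1}))
  let FB := (Equiv.refl (s₀.labels ν).inn).sumCongr
      (e.symm.sigmaCongrLeft (β := fun i => ((s i).labels ν).out))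
  let FE := (Equiv.refl (s₀.labels ν).out).sumCongr
      (e.symm.sigmaCongrLeft (β := fun i => ((s i).labels ν).inn))
  have hB : FB (beginLabelEquiv ν (fun j => s (e.symm j)) s₀ b) = beginLabelEquiv ν s s₀ (EB b) := by
    rcases b with b | ⟨j, b⟩ <;> rfl
  have hE : ∀ y, FE (endLabelEquiv ν (fun j => s (e.symm j)) s₀ y) = endLabelEquiv ν s s₀ (EE y) := by
    rintro (y | ⟨j, y⟩) <;> rfl
  have h1 : (T.reindex e).matching b = EE.symm (T.matching (EB b)) := rfl
  have h2 : ((T.forget ν).reindex e).matching (beginLabelEquiv ν (fun j => s (e.symm j)) s₀ b) =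
    FE.symm ((T.forget ν).matching (FB (beginLabelEquiv ν (fun j => s (e.symm j)) s₀ b))) := rfl
  rw [h1, h2, Equiv.eq_symm_apply, hE, hB, Equiv.apply_symm_apply, forget_matching]

/-- Passing from marks to labels turns `markGluing` into `gluingData` (this is `hq`), so both
gluings produce the same intervals and equally many circles; `matching_eq` and `circles_eq` identify
these with the strands of `T''`. -/
theorem IsComp.forget_eq [Finite ι] [Finite κ] {T : PlanarTangle s s₀} {i : ι} {s' : κ → SignSeq}
    {T' : PlanarTangle s' (s i)}
    {T'' : PlanarTangle (Sum.elim (fun j : {j // j ≠ i} => s j.1) s') s₀}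
    (h : T.IsComp i T' T'') :
    (T''.forget ν).cast (labels_comp_elim ν s i s') = (T.forget ν).comp i (T'.forget ν) := by
  let eX := (beginLabelEquiv ν (Sum.elim (fun j : {j // j ≠ i} => s j.1) s') s₀).trans
    (castBegin (labels_comp_elim ν s i s'))
  let eY := (endLabelEquiv ν (Sum.elim (fun j : {j // j ≠ i} => s j.1) s') s₀).trans
    (castEnd (labels_comp_elim ν s i s'))
  let eG := (labelsOfEquiv ν fun j => (s i).sign j = -1).sumCongr
    (labelsOfEquiv ν fun j => (s i).sign j = 1)
  let c := fun j => (s j).labels ν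
  let c' := fun m => (s' m).labels ν
  let c₀ := s₀.labels ν
  have hB : ∀ z, splitEquiv (fun a : LabelPair L => a.out) c₀.inn (c i).inn c i c'
      (eX.sumCongr eG z) = (beginLabelEquiv ν s s₀).sumCongr (beginLabelEquiv ν s' (s i))
        (splitBegin s s₀ i s' z) := by
    rintro ((z | ⟨j | m, z⟩) | (z | z)) <;> rfl
  have hE : ∀ z, splitEquiv (fun a : LabelPair L => a.inn) c₀.out (c i).out c i c'
      ((Equiv.refl _).sumCongr (Equiv.sumComm _ _) (eY.sumCongr eG z)) =
        (endLabelEquiv ν s s₀).sumCongr (endLabelEquiv ν s' (s i)) (splitEnd s s₀ i s' z) := by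
    rintro ((z | ⟨j | m, z⟩) | (z | z)) <;> rfl
  have hq : ∀ z, (T.forget ν).gluingData i (T'.forget ν) (eX.sumCongr eG z) =
      eY.sumCongr eG (T.markGluing i T' z) := by
    intro z
    have h1 : (T.forget ν).gluingData i (T'.forget ν) (eX.sumCongr eG z) =
        (Equiv.refl _).sumCongr (Equiv.sumComm _ _)
          ((splitEquiv (fun a : LabelPair L => a.inn) c₀.out (c i).out c i c').symm
            ((T.forget ν).matching.sumCongr (T'.forget ν).matching
              (splitEquiv (fun a : LabelPair L => a.out) c₀.inn (c i).inn c i c'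
                (eX.sumCongr eG z)))) := rfl
    have h2 : ∀ y, (T.forget ν).matching.sumCongr (T'.forget ν).matching
        ((beginLabelEquiv ν s s₀).sumCongr (beginLabelEquiv ν s' (s i)) y) =
          (endLabelEquiv ν s s₀).sumCongr (endLabelEquiv ν s' (s i))
            (T.matching.sumCongr T'.matching y) := by
      rintro (y | y)
      · exact congrArg Sum.inl (T.forget_matching ν y)
      · exact congrArg Sum.inr (T'.forget_matching ν y)
    have h3 : splitEnd s s₀ i s' (T.markGluing i T' z) =
        T.matching.sumCongr T'.matching (splitBegin s s₀ i s' z) := by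
      simp [markGluing]
    rw [h1, hB, h2, ← h3, ← hE, Equiv.symm_apply_apply]
    rcases eY.sumCongr eG (T.markGluing i T' z) with y | (y | y) <;> rfl
  refine WiringDiagram.ext (Equiv.ext fun x => ?_) ?_
  · obtain ⟨b, rfl⟩ := eX.surjective x
    have h1 : ((T''.forget ν).cast (labels_comp_elim ν s i s')).matching (eX b) =
        eY (T''.matching b) :=
      (WiringDiagram.cast_matching _ _ _).trans (congrArg _ (T''.forget_matching ν b))
    obtain ⟨e, he⟩ := glueLeads_exists (T.markGluing i T') b
    have h2 : GlueLeads ((T.forget ν).gluingData i (T'.forget ν)) (eX b)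
        (((T.forget ν).comp i (T'.forget ν)).matching (eX b)) :=
      (glueLeads_exists ((T.forget ν).gluingData i (T'.forget ν)) (eX b)).choose_spec
    rw [h1, h.matching_eq he]
    exact glueLeads_unique _ (he.relabel hq) h2
  · rw [WiringDiagram.cast_circles]
    refine h.circles_eq.trans ?_
    rw [← glueCircles_relabel hq]
    rfl

end PlanarTangle

/-- A circuit algebra restricts to a planar algebra. -/
theorem IsCircuitAlgebra.restrictAction {k : Type u} [Field k] (ν : ℕ ↪ L)
    {A : CircuitAction.{w} k L} (hA : IsCircuitAlgebra A) :
    IsPlanarAlgebra ((restrictAction ν).obj A) where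
  isotopy T T' h := congrArg (fun D => A.act D) (h.forget_eq ν)
  unit a x := by
    refine Eq.trans ?_ (hA.unit (a.labels ν) x)
    exact congrArg (fun D : WiringDiagram _ _ => A.act D x) (PlanarTangle.forget_id ν a)
  comp {r r' t s s₀} T i s' T' T'' e x h := by
    have h1 := (congrArg (fun D : WiringDiagram _ _ => A.act D fun j => x (e.symm j))
      (T''.forget_reindex ν e))
    refine h1.trans ?_
    let x' : ∀ z, A.V (Sum.elim (fun j : {j // j ≠ i} => (s j.1).labels ν)
        (fun m => (s' m).labels ν) z) := fun z =>
      cast (congrArg (fun c => (A.V (c z) : Type w)) (labels_comp_elim ν s i s')) (x z)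
    refine (act_reindex_cast A (labels_comp_elim ν s i s') (T''.forget ν) e x x'
      fun _ => rfl).trans ?_
    rw [h.forget_eq ν]
    exact hA.comp (T.forget ν) i (T'.forget ν) e x'
  perm T e x := by
    refine Eq.trans ?_ (hA.perm (T.forget ν) e x)
    exact congrArg (fun D : WiringDiagram _ _ => A.act D fun j => x (e.symm j))
      (T.forget_reindex ν e)

/-! ### The circuit algebra generated by a planar algebra -/

theorem map_plug {ι : Type} [DecidableEq ι] {X : ι → Type*} {Y : ι → Type*} (f : ∀ j, X j → Y j)
    (i : ι) (x : ∀ j : {j // j ≠ i}, X j.1) (v : X i) :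
    (fun j => f j (plug i x v j)) = plug i (fun j => f j.1 (x j)) (f i v) := by
  funext j
  unfold plug
  split_ifs with h
  · subst h
    rfl
  · rfl

namespace PlanarAction

variable {k : Type u} [Field k] {L : Type} (ν : ℕ ↪ L) (A : PlanarAction.{max u w} k)

/-- The formal expressions that can be formed from elements of `A` in a circuit algebra. -/
inductive Term : LabelPair L → Type (max u w)
  | of (s : SignSeq) (a : A.V s) : Term (s.labels ν)
  | zero (c : LabelPair L) : Term c
  | add {c : LabelPair L} (x y : Term c) : Term c
  | neg {c : LabelPair L} (x : Term c) : Term c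
  | smul {c : LabelPair L} (r : k) (x : Term c) : Term c
  | act {r : ℕ} {c : Fin r → LabelPair L} {c₀ : LabelPair L} (D : WiringDiagram c c₀)
      (x : ∀ j, Term (c j)) : Term c₀

variable {ν A}

/-- The value of a formal expression in a circuit algebra. -/
noncomputable def Term.eval {B : CircuitAction.{max u w} k L} (f : A ⟶ (restrictAction ν).obj B) :
    ∀ {c : LabelPair L}, Term.{w} ν A c → B.V c
  | _, .of s a => f.app s a
  | _, .zero _ => 0
  | _, .add x y => x.eval f + y.eval f
  | _, .neg x => -x.eval f
  | _, .smul r x => r • x.eval f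
  | _, .act D x => B.act D fun j => (x j).eval f

variable (ν A)

/-- Two expressions are identified if they have the same value in every circuit algebra. -/
def termSetoid (c : LabelPair L) : Setoid (Term.{w} ν A c) where
  r x y := ∀ (B : CircuitAction.{max u w} k L), IsCircuitAlgebra B →
    ∀ f : A ⟶ (restrictAction ν).obj B, x.eval f = y.eval f
  iseqv := ⟨fun _ _ _ _ => rfl, fun h B hB f => (h B hB f).symm,
    fun h h' B hB f => (h B hB f).trans (h' B hB f)⟩

/-- The elements of the generated circuit algebra. -/
def Generated (c : LabelPair L) : Type (max u w) := Quotient (termSetoid.{w} ν A c)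

/-! ### Linear structure on classes of expressions -/

namespace Generated

variable {ν A} {c : LabelPair L}

/-- The element that is given by an expression. -/
def mk (x : Term.{w} ν A c) : Generated.{w} ν A c := Quotient.mk _ x

/-- The map to a circuit algebra that is induced by a morphism from `A`. -/
noncomputable def eval {B : CircuitAction.{max u w} k L} (hB : IsCircuitAlgebra B)
    (f : A ⟶ (restrictAction ν).obj B) : Generated.{w} ν A c → B.V c :=
  Quotient.lift (fun x => x.eval f) fun _ _ h => h B hB f

-- Evaluations are jointly injective by the choice of the relation, so every identity in the
-- quotient may be checked in actual circuit algebras.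
@[ext]
theorem ext {x y : Generated.{w} ν A c} (h : ∀ (B : CircuitAction.{max u w} k L)
    (hB : IsCircuitAlgebra B) (f : A ⟶ (restrictAction ν).obj B), eval hB f x = eval hB f y) :
    x = y := by
  induction x using Quotient.inductionOn
  induction y using Quotient.inductionOn
  exact Quotient.sound h

/-- The element of the quotient that is represented by an expression in representatives. -/
noncomputable def repr (x : Generated.{w} ν A c) : Term.{w} ν A c := Quotient.out x

variable {B : CircuitAction.{max u w} k L} (hB : IsCircuitAlgebra B)
  (f : A ⟶ (restrictAction ν).obj B)

-- The operations below are defined through chosen representatives; they are well behaved because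
-- evaluation does not see the choice.
@[simp]
theorem repr_eval (x : Generated.{w} ν A c) : x.repr.eval f = eval hB f x := by
  conv_rhs => rw [← Quotient.out_eq x]
  rfl

noncomputable instance : Zero (Generated.{w} ν A c) := ⟨mk (.zero c)⟩
noncomputable instance : Add (Generated.{w} ν A c) := ⟨fun x y => mk (.add x.repr y.repr)⟩
noncomputable instance : Neg (Generated.{w} ν A c) := ⟨fun x => mk (.neg x.repr)⟩
noncomputable instance : SMul k (Generated.{w} ν A c) := ⟨fun r x => mk (.smul r x.repr)⟩

@[simp]
theorem eval_zero : eval hB f (0 : Generated.{w} ν A c) = 0 := rfl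

@[simp]
theorem eval_add (x y : Generated.{w} ν A c) : eval hB f (x + y) = eval hB f x + eval hB f y := by
  rw [← repr_eval hB f x, ← repr_eval hB f y]; rfl

@[simp]
theorem eval_neg (x : Generated.{w} ν A c) : eval hB f (-x) = -eval hB f x := by
  rw [← repr_eval hB f x]; rfl

@[simp]
theorem eval_smul (r : k) (x : Generated.{w} ν A c) : eval hB f (r • x) = r • eval hB f x := by
  rw [← repr_eval hB f x]; rfl

noncomputable instance : AddCommGroup (Generated.{w} ν A c) where
  add_assoc x y z := by ext B hB f; simp [add_assoc]
  zero_add x := by ext B hB f; simp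
  add_zero x := by ext B hB f; simp
  neg_add_cancel x := by ext B hB f; simp
  add_comm x y := by ext B hB f; simp [add_comm]
  nsmul := nsmulRec
  zsmul := zsmulRec

noncomputable instance : Module k (Generated.{w} ν A c) where
  one_smul x := by ext B hB f; simp
  mul_smul r r' x := by ext B hB f; simp [mul_smul]
  smul_zero r := by ext B hB f; simp
  smul_add r x y := by ext B hB f; simp
  add_smul r r' x := by ext B hB f; simp [add_smul]
  zero_smul x := by ext B hB f; simp

end Generated

/-! ### Operations on the quotient and its universal property -/

/-- The operation of a wiring diagram on the generated circuit algebra. -/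
noncomputable def generatedAct {r : ℕ} {c : Fin r → LabelPair L} {c₀ : LabelPair L}
    (D : WiringDiagram c c₀) (x : ∀ j, Generated.{w} ν A (c j)) : Generated.{w} ν A c₀ :=
  .mk (.act D fun j => (x j).repr)

variable {ν A} in
theorem eval_generatedAct {B : CircuitAction.{max u w} k L} (hB : IsCircuitAlgebra B)
    (f : A ⟶ (restrictAction ν).obj B) {r : ℕ} {c : Fin r → LabelPair L} {c₀ : LabelPair L}
    (D : WiringDiagram c c₀) (x : ∀ j, Generated.{w} ν A (c j)) :
    (generatedAct ν A D x).eval hB f = B.act D fun j => (x j).eval hB f := by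
  refine congrArg (B.act D) (funext fun j => ?_)
  exact Generated.repr_eval hB f (x j)

/-- The circuit algebra generated by a planar algebra. -/
noncomputable def generated : CircuitAction.{max u w} k L where
  V c := ModuleCat.of k (Generated.{w} ν A c)
  act r c c₀ D :=
    { toFun := generatedAct ν A D
      map_update_add' := fun {_} x i y z => by
        -- Multilinearity is demanded for an arbitrary decidability instance, which is replaced by
        -- the standard one.
        obtain rfl := Subsingleton.elim ‹DecidableEq (Fin r)› (instDecidableEqFin r)
        refine Generated.ext fun B hB f => ?_
        have h := fun v => funext fun j =>
          Function.apply_update (fun j (y : Generated.{w} ν A (c j)) => y.eval hB f) x i v j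
        rw [Generated.eval_add, eval_generatedAct, eval_generatedAct, eval_generatedAct]
        erw [h, h, h]
        rw [← MultilinearMap.map_update_add]
        congr 2
        exact Generated.eval_add hB f y z
      map_update_smul' := fun {_} x i a y => by
        obtain rfl := Subsingleton.elim ‹DecidableEq (Fin r)› (instDecidableEqFin r)
        refine Generated.ext fun B hB f => ?_
        have h := fun v => funext fun j =>
          Function.apply_update (fun j (y : Generated.{w} ν A (c j)) => y.eval hB f) x i v j
        rw [Generated.eval_smul, eval_generatedAct, eval_generatedAct]
        erw [h, h]
        rw [← MultilinearMap.map_update_smul]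
        congr 2
        exact Generated.eval_smul hB f a y }

theorem isCircuitAlgebra_generated : IsCircuitAlgebra (generated.{w} ν A) where
  unit a x := Generated.ext fun B hB f =>
    (eval_generatedAct hB f _ _).trans (hB.unit a fun j => (x j).eval hB f)
  comp D i c' D' e x := Generated.ext fun B hB f => by
    refine (eval_generatedAct hB f _ _).trans ?_
    refine (hB.comp D i D' e fun z => Generated.eval hB f (x z)).trans ?_
    refine Eq.trans ?_ (eval_generatedAct hB f _ _).symm
    refine congrArg (B.act D) ?_
    refine Eq.trans ?_ (map_plug (fun j (y : Generated.{w} ν A _) => y.eval hB f) i _ _).symm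
    exact congrArg _ (eval_generatedAct hB f _ _).symm
  perm D e x := Generated.ext fun B hB f =>
    (eval_generatedAct hB f _ _).trans ((hB.perm D e fun j => Generated.eval hB f (x j)).trans
      (eval_generatedAct hB f _ _).symm)

/-- The morphism from a planar algebra to the generated circuit algebra. -/
noncomputable def generatedUnit : A ⟶ (restrictAction ν).obj (generated.{w} ν A) where
  app s :=
    { toFun := fun a => Generated.mk (.of s a)
      map_add' := fun a b => Generated.ext fun B hB f => by
        refine ((f.app s).map_add a b).trans ?_
        exact (Generated.eval_add hB f (.mk (.of s a)) (.mk (.of s b))).symm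
      map_smul' := fun r a => Generated.ext fun B hB f => by
        refine ((f.app s).map_smul r a).trans ?_
        exact (Generated.eval_smul hB f r (.mk (.of s a))).symm }
  comm _ _ _ T x := Generated.ext fun B hB f =>
    (f.comm T x).trans (eval_generatedAct hB f (T.forget ν) fun j => .mk (.of _ (x j))).symm

variable {ν A}

/-- The morphism from the generated circuit algebra that extends a morphism from `A`. -/
noncomputable def generatedDesc {B : CircuitAction.{max u w} k L} (hB : IsCircuitAlgebra B)
    (f : A ⟶ (restrictAction ν).obj B) : generated.{w} ν A ⟶ B where
  app _ :=
    { toFun := Generated.eval hB f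
      map_add' := Generated.eval_add hB f
      map_smul' := Generated.eval_smul hB f }
  comm _ _ _ D x := eval_generatedAct hB f D x

/-- The uniqueness half of the universal property: `g` is linear and commutes with all operations,
so its values on expressions are forced by those on generators. In each case of the induction, the
class of a compound expression is the operation applied to the classes of its parts, which is again
checked by evaluation. -/
theorem eval_of_hom {B : CircuitAction.{max u w} k L} (g : generated.{w} ν A ⟶ B)
    {c : LabelPair L} (x : Term.{w} ν A c) :
    x.eval (generatedUnit ν A ≫ (restrictAction ν).map g) = g.app c (Generated.mk x) := by
  induction x with
  | of s a => rfl
  | zero c => exact ((g.app c).map_zero).symm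
  | @add c x y hx hy =>
    refine (congrArg₂ (· + ·) hx hy).trans (((g.app c).map_add _ _).symm.trans ?_)
    refine congrArg (g.app c) (Generated.ext fun B hB f => ?_)
    exact Generated.eval_add hB f (.mk x) (.mk y)
  | @neg c x hx =>
    refine (congrArg (- ·) hx).trans (((g.app c).map_neg _).symm.trans ?_)
    refine congrArg (g.app c) (Generated.ext fun B hB f => ?_)
    exact Generated.eval_neg hB f (.mk x)
  | @smul c r x hx =>
    refine (congrArg (r • ·) hx).trans (((g.app c).map_smul _ _).symm.trans ?_)
    refine congrArg (g.app c) (Generated.ext fun B hB f => ?_)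
    exact Generated.eval_smul hB f r (.mk x)
  | @act r c c₀ D x hx =>
    refine (congrArg (B.act D) (funext hx)).trans ((g.comm D _).symm.trans ?_)
    refine congrArg (g.app c₀) (Generated.ext fun B hB f => ?_)
    exact eval_generatedAct hB f D fun j => .mk (x j)

/-- Morphisms from the generated circuit algebra are the same as morphisms from `A`. -/
noncomputable def generatedEquiv {B : CircuitAction.{max u w} k L} (hB : IsCircuitAlgebra B) :
    (generated.{w} ν A ⟶ B) ≃ (A ⟶ (restrictAction ν).obj B) where
  toFun g := generatedUnit ν A ≫ (restrictAction ν).map g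
  invFun f := generatedDesc hB f
  left_inv g := OperadAction.Hom.ext (funext fun c => LinearMap.ext fun x => by
    induction x using Quotient.inductionOn with
    | h x => exact eval_of_hom g x)
  -- A generator evaluates to its image under `f` by definition.
  right_inv f := rfl

end PlanarAction

/-- The functor which sends a planar algebra to the circuit algebra generated by it is left adjoint
to restriction. -/
theorem exists_leftAdjoint_restriction {k : Type u} [Field k] {L : Type} (ν : ℕ ↪ L)
    (h : ∀ A : CircuitAction.{max u w} k L, IsCircuitAlgebra A →
      IsPlanarAlgebra ((restrictAction ν).obj A)) :
    ∃ φ : PlanarAlgebra.{max u w} k ⥤ CircuitAlgebra.{max u w} k L,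
      Nonempty (φ ⊣ restriction ν h) := by
  let F : PlanarAlgebra.{max u w} k → CircuitAlgebra.{max u w} k L := fun A =>
    ⟨PlanarAction.generated.{w} ν A.obj, PlanarAction.isCircuitAlgebra_generated ν A.obj⟩
  let e : ∀ A B, (F A ⟶ B) ≃ (A ⟶ (restriction ν h).obj B) := fun A B =>
    { toFun := fun g => ⟨PlanarAction.generatedEquiv B.property g.hom⟩
      invFun := fun f => ⟨(PlanarAction.generatedEquiv B.property).symm f.hom⟩
      left_inv := fun g => InducedCategory.hom_ext (Equiv.symm_apply_apply _ _)
      right_inv := fun f => InducedCategory.hom_ext (Equiv.apply_symm_apply _ _) }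
  -- Bijections natural in the circuit algebra suffice: they determine the action of the left
  -- adjoint on morphisms.
  exact ⟨_, ⟨Adjunction.adjunctionOfEquivLeft e fun A B B' g f => rfl⟩⟩

theorem proposition3p4 {k : Type u} [Field k] {L : Type} [Countable L] (ν : ℕ ↪ L) :
    -- composable planar tangles can be composed
    (∀ {r r' : ℕ} {s : Fin r → SignSeq} {s₀ : SignSeq} (T : PlanarTangle s s₀) (i : Fin r)
      {s' : Fin r' → SignSeq} (T' : PlanarTangle s' (s i)), ∃ T'', T.IsComp i T' T'') ∧
    -- the wiring diagram of a tangle depends only on its isotopy class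
    (∀ {r : ℕ} {s : Fin r → SignSeq} {s₀ : SignSeq} (T T' : PlanarTangle s s₀),
      T.Isotopic T' → T.forget ν = T'.forget ν) ∧
    -- and this assignment is compatible with units, compositions and the symmetric group actions
    (∀ a : SignSeq, (PlanarTangle.id a).forget ν = WiringDiagram.id (a.labels ν)) ∧
    (∀ {r r' : ℕ} {s : Fin r → SignSeq} {s₀ : SignSeq} (T : PlanarTangle s s₀) (i : Fin r)
      {s' : Fin r' → SignSeq} (T' : PlanarTangle s' (s i))
      (T'' : PlanarTangle (Sum.elim (fun j : {j // j ≠ i} => s j.1) s') s₀), T.IsComp i T' T'' →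
      (T''.forget ν).cast (labels_comp_elim ν s i s') = (T.forget ν).comp i (T'.forget ν)) ∧
    (∀ {r : ℕ} {s : Fin r → SignSeq} {s₀ : SignSeq} (T : PlanarTangle s s₀)
      (e : Equiv.Perm (Fin r)), (T.reindex e).forget ν = (T.forget ν).reindex e) ∧
    -- so that every circuit algebra restricts to a planar algebra, and restriction has a left adjoint
    ∃ h : ∀ A : CircuitAction.{max u w} k L, IsCircuitAlgebra A →
        IsPlanarAlgebra ((restrictAction ν).obj A),
      ∃ φ : PlanarAlgebra.{max u w} k ⥤ CircuitAlgebra.{max u w} k L,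
        Nonempty (φ ⊣ restriction ν h) := by
  have h : ∀ A : CircuitAction.{max u w} k L, IsCircuitAlgebra A →
      IsPlanarAlgebra ((restrictAction ν).obj A) := fun _ hA => hA.restrictAction ν
  exact ⟨fun T i _ T' => T.exists_isComp i T', fun _ _ h => h.forget_eq ν,
    PlanarTangle.forget_id ν, fun _ _ _ _ _ h => h.forget_eq ν,
    fun T e => T.forget_reindex ν e, h, exists_leftAdjoint_restriction.{w} ν h⟩
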